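/- A function $f:\mathbb N\to\mathbb C$ is called additive if $f(ab)=f(a)+f(b)$ whenever $(a,b)=1$. Let $\mathcal F_0$ be the set of all additive functions $f$ with $f(p)=1$ for every prime $p$. For $f\in\mathcal F_0$, $\alpha\in\mathbb R$ and a real number $X\ge 2$ put $$S_f(\alpha;X)=\sum_{1\le n\le X} f(n)\,e^{2\pi i\alpha n},\qquad F_f(X)=\max_{p^\ell\le X}|f(p^\ell)|,$$ where the maximum runs over all prime powers $p^\ell$ ($p$ prime, $\ell\ge 1$) not exceeding $X$. There are absolute constants $C>0$ and $X_0\ge 2$ such that the following holds. Let $f\in\mathcal F_0$, let $\alpha\in\mathbb R$, $a\in\mathbb Z$ and let $q\ge 1$ be an integer with $(a,q)=1$ and $|\alpha-a/q|\le q^{-2}$. Then for every $\Delta\in(0,\tfrac12)$ and every real $X\ge X_0$, $$|S_f(\alpha;X)|\le C\left(\frac{X}{q^{\Delta}}+X^{5/6}+X^{1-\Delta}q^{\Delta}\right)\left((\log X)^4+(\log X)\,F_f(X)\right).$$ -/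

import Mathlib

/-- The class `𝓕₀`: additive arithmetic functions `f : ℕ → ℂ` (that is, `f (a * b) = f a + f b`
for coprime positive integers `a`, `b`) such that `f p = 1` for every prime `p`.
The value `f 0` is irrelevant. -/
structure IsClassFZero (f : ℕ → ℂ) : Prop where
  additive : ∀ a b : ℕ, 0 < a → 0 < b → Nat.Coprime a b → f (a * b) = f a + f b
  prime_eq_one : ∀ p : ℕ, p.Prime → f p = 1

/-- The exponential sum `S_f(α; X) = ∑_{1 ≤ n ≤ X} f(n) e(α n)`, where `e(θ) = exp(2πiθ)`. -/
noncomputable def expSum (f : ℕ → ℂ) (α X : ℝ) : ℂ :=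
  ∑ n ∈ Finset.Icc 1 ⌊X⌋₊, f n * Complex.exp (2 * Real.pi * Complex.I * (α * n : ℝ))

/-- The values `|f(p^ℓ)|` over the prime powers `p^ℓ ≤ X`, `ℓ ≥ 1`. -/
def primePowValues (f : ℕ → ℂ) (X : ℝ) : Set ℝ :=
  {r : ℝ | ∃ p l : ℕ, p.Prime ∧ 1 ≤ l ∧ ((p ^ l : ℕ) : ℝ) ≤ X ∧ r = ‖f (p ^ l)‖}

/-- `F_f(X) = max_{p^ℓ ≤ X} |f(p^ℓ)|`. -/
noncomputable def primePowMax (f : ℕ → ℂ) (X : ℝ) : ℝ :=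
  sSup (primePowValues f X)

/-- For `X ≥ 2` the supremum defining `F_f(X)` is a maximum. -/
theorem primePowMax_isGreatest (f : ℕ → ℂ) (X : ℝ) (hX : 2 ≤ X) :
    IsGreatest (primePowValues f X) (primePowMax f X) := by
  have hfin : (primePowValues f X).Finite := by
    refine ((Set.finite_Iic ⌊X⌋₊).image (fun n => ‖f n‖)).subset ?_
    rintro r ⟨p, l, -, -, h, rfl⟩
    exact ⟨p ^ l, Nat.le_floor h, rfl⟩
  have hne : (primePowValues f X).Nonempty :=
    ⟨‖f (2 ^ 1)‖, 2, 1, Nat.prime_two, le_rfl, by simpa using hX, rfl⟩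
  exact ⟨hne.csSup_mem hfin, fun r hr => le_csSup hfin.bddAbove hr⟩

/-! Let `M = ⌊X⌋`. If `q > M`, the term `X^(1-Δ) q^Δ` already exceeds `X` and a pointwise bound on
`f` suffices. If `q ≤ M`, fix `U ≈ M^(1/3)` and split `f` into `ω`, the number of distinct prime
factors, and the corrections `f(p^k) - 1` with `k ≥ 2` (`IsClassFZero.sum_eq`).

The corrections reduce to sums of `e(αn)` over multiples of prime powers. Moduli up to `U²` are
covered by a linear (type I) bound, larger ones by the sparsity of higher prime powers.

For `ω`, primes `p ≤ U²` again give linear sums. Since `M ≤ U⁴`, an integer `n ≤ M` has at most one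
prime factor above `U²`, so the large primes contribute the full sum of `e(αn)` minus the sum over
`U²`-smooth `n` (`sum_multipleSum_large_prime_eq`). A smooth `n > U` factors uniquely as `x * b`,
where `x` collects the largest primes and `U < x ≤ U²` (`existsUnique_mul_eq`). This is a bilinear
sum whose variables are tied only by `maxFac b ≤ x.minFac`; `sum_norm_sq_triangular_le` removes that
condition at logarithmic cost, and the correlations left are geometric sums controlled by the
rational approximation to `α`. -/

/-! ### Exponentials, distance to the nearest integer, geometric sums. -/

/-- `e(x) = exp(2πix)`. -/
noncomputable def expTwoPi (x : ℝ) : ℂ := Complex.exp (2 * Real.pi * Complex.I * x)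

theorem norm_expTwoPi (x : ℝ) : ‖expTwoPi x‖ = 1 := by
  rw [expTwoPi, show (2 * Real.pi * Complex.I * x : ℂ) = ((2 * Real.pi * x : ℝ) : ℂ) * Complex.I by
    push_cast; ring]
  exact Complex.norm_exp_ofReal_mul_I _

theorem expTwoPi_add (x y : ℝ) : expTwoPi (x + y) = expTwoPi x * expTwoPi y := by
  rw [expTwoPi, expTwoPi, expTwoPi, ← Complex.exp_add]
  congr 1
  push_cast
  ring

theorem conj_expTwoPi (x : ℝ) : (starRingEnd ℂ) (expTwoPi x) = expTwoPi (-x) := by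
  rw [expTwoPi, expTwoPi, ← Complex.exp_conj]
  congr 1
  simp [Complex.conj_ofNat]

theorem expTwoPi_intCast (m : ℤ) : expTwoPi m = 1 := by
  rw [expTwoPi, Complex.exp_eq_one_iff]
  exact ⟨m, by push_cast; ring⟩

/-- Distance to the nearest integer. -/
noncomputable def distInt (x : ℝ) : ℝ := ‖(x : UnitAddCircle)‖

theorem distInt_eq (x : ℝ) : distInt x = |x - round x| := UnitAddCircle.norm_eq

theorem distInt_nonneg (x : ℝ) : 0 ≤ distInt x := norm_nonneg _

theorem distInt_le_half (x : ℝ) : distInt x ≤ 1 / 2 := by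
  rw [distInt_eq]; exact abs_sub_round x

theorem distInt_le_abs_sub (x : ℝ) (m : ℤ) : distInt x ≤ |x - m| := by
  rw [distInt_eq]; exact round_le x m

/-- Jordan's inequality for `|e(t) - 1| = 2|sin πt|`, with `t` the representative in `[-1/2, 1/2]`.
-/
theorem distInt_le_norm_expTwoPi_sub_one (x : ℝ) : 4 * distInt x ≤ ‖expTwoPi x - 1‖ := by
  set t := x - round x with ht
  have h1 : expTwoPi x = expTwoPi t := by
    rw [show x = t + ((round x : ℤ) : ℝ) by rw [ht]; ring, expTwoPi_add, expTwoPi_intCast, mul_one]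
  have ht2 : |t| ≤ 1 / 2 := abs_sub_round x
  have h2 : ‖expTwoPi t - 1‖ = ‖2 * Real.sin (Real.pi * t)‖ := by
    have := Complex.norm_exp_I_mul_ofReal_sub_one (2 * Real.pi * t)
    rw [expTwoPi, show (2 * Real.pi * Complex.I * t : ℂ)
      = Complex.I * ((2 * Real.pi * t : ℝ) : ℂ) by push_cast; ring, this]
    congr 3; ring
  have h3 := Real.mul_abs_le_abs_sin (x := Real.pi * t) (by
    rw [abs_mul, abs_of_pos Real.pi_pos]; nlinarith [Real.pi_pos])
  rw [distInt_eq, h1, h2, ← ht, norm_mul, Real.norm_eq_abs, Real.norm_eq_abs, abs_two]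
  rw [abs_mul, abs_of_pos Real.pi_pos] at h3
  have : 2 / Real.pi * (Real.pi * |t|) = 2 * |t| := by field_simp
  linarith

theorem norm_sum_expTwoPi_le (θ : ℝ) (M : ℕ) :
    ‖∑ m ∈ Finset.Icc 1 M, expTwoPi (θ * m)‖ ≤ M := by
  refine (norm_sum_le _ _).trans ?_
  simp [norm_expTwoPi]

/-- The geometric sum telescopes after multiplication by `e(θ) - 1`. The product form remains
meaningful when `θ` is an integer. -/
theorem norm_sum_expTwoPi_mul_distInt_le (θ : ℝ) (M : ℕ) :
    ‖∑ m ∈ Finset.Icc 1 M, expTwoPi (θ * m)‖ * distInt θ ≤ 1 := by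
  have h : (∑ m ∈ Finset.Icc 1 M, expTwoPi (θ * m)) * (expTwoPi θ - 1)
      = expTwoPi (θ * (M + 1)) - expTwoPi θ := by
    induction M with
    | zero => simp
    | succ k ih =>
      rw [Finset.sum_Icc_succ_top (by omega), add_mul, ih, mul_sub, ← expTwoPi_add]
      push_cast
      ring_nf
  have h2 : ‖∑ m ∈ Finset.Icc 1 M, expTwoPi (θ * m)‖ * ‖expTwoPi θ - 1‖ ≤ 2 := by
    rw [← norm_mul, h]
    refine (norm_sub_le _ _).trans ?_
    rw [norm_expTwoPi, norm_expTwoPi]; norm_num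
  nlinarith [distInt_le_norm_expTwoPi_sub_one θ,
    norm_nonneg (∑ m ∈ Finset.Icc 1 M, expTwoPi (θ * m))]

/-! ### Sums over well-spaced points and rational approximation. -/

theorem sum_one_div_le_one_add_log (n : ℕ) :
    ∑ j ∈ Finset.Icc 1 n, (1 : ℝ) / j ≤ 1 + Real.log n := by
  have := harmonic_le_one_add_log n
  rw [harmonic_eq_sum_Icc] at this
  simpa using this

/-- Sort the points by the side of the nearest integer on which they lie and by their distance to it
in units of `1/(2Q)`. Spacing allows one point per class. The two classes at distance index `0` cost
`Y` each; those at index `j ≥ 1` cost `2Q/j`, a harmonic sum. -/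
theorem sum_le_of_spaced {ι : Type*} (s : Finset ι) (θ w : ι → ℝ) (Q : ℕ) (hQ : 0 < Q) (Y : ℝ)
    (hY : 0 ≤ Y) (hwY : ∀ i ∈ s, w i ≤ Y) (hw : ∀ i ∈ s, w i * distInt (θ i) ≤ 1)
    (hs : ∀ i ∈ s, ∀ j ∈ s, i ≠ j → 1 / (2 * Q : ℝ) ≤ distInt (θ i - θ j)) :
    ∑ i ∈ s, w i ≤ 2 * Y + 4 * Q * (1 + Real.log Q) := by
  classical
  have hQ' : (0 : ℝ) < Q := by exact_mod_cast hQ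
  let key : ι → Bool × ℕ := fun i => (decide (0 ≤ θ i - round (θ i)), ⌊2 * Q * distInt (θ i)⌋₊)
  let h : ℕ → ℝ := fun j => if j = 0 then Y else 2 * Q * (1 / j)
  have hh : ∀ j, 0 ≤ h j := fun j => by
    simp only [h]; split_ifs <;> positivity
  have hle : ∀ i ∈ s, w i ≤ h (key i).2 := by
    intro i hi
    simp only [h, key]
    split_ifs with h0
    · exact hwY i hi
    · have h1 : (⌊2 * Q * distInt (θ i)⌋₊ : ℝ) ≤ 2 * Q * distInt (θ i) :=
        Nat.floor_le (mul_nonneg (by positivity) (distInt_nonneg _))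
      have h2 : (0 : ℝ) < ⌊2 * Q * distInt (θ i)⌋₊ := by
        exact_mod_cast Nat.pos_of_ne_zero h0
      rw [mul_one_div, le_div_iff₀ h2]
      rcases le_or_gt (w i) 0 with hneg | hpos
      · nlinarith
      · nlinarith [hw i hi]
  have hinj : Set.InjOn key s := by
    intro i hi j hj hij
    by_contra hne
    have h1 := hs i hi j hj hne
    simp only [key, Prod.mk.injEq, decide_eq_decide] at hij
    obtain ⟨hsgn, hfl⟩ := hij
    have h2 : distInt (θ i - θ j) ≤ |(θ i - round (θ i)) - (θ j - round (θ j))| := by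
      have := distInt_le_abs_sub (θ i - θ j) (round (θ i) - round (θ j))
      push_cast at this
      convert this using 2
      ring
    have h3 : |2 * Q * distInt (θ i) - 2 * Q * distInt (θ j)| < 1 := by
      have a1 := Nat.floor_le (a := 2 * Q * distInt (θ i)) (mul_nonneg (by positivity) (distInt_nonneg _))
      have a2 := Nat.floor_le (a := 2 * Q * distInt (θ j)) (mul_nonneg (by positivity) (distInt_nonneg _))
      have a3 := Nat.lt_floor_add_one (2 * Q * distInt (θ i))
      have a4 := Nat.lt_floor_add_one (2 * Q * distInt (θ j))
      rw [hfl] at a1 a3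
      rw [abs_lt]; constructor <;> linarith
    have h4 : |(θ i - round (θ i)) - (θ j - round (θ j))| = |distInt (θ i) - distInt (θ j)| := by
      rw [distInt_eq, distInt_eq]
      by_cases hp : 0 ≤ θ i - round (θ i)
      · rw [abs_of_nonneg hp, abs_of_nonneg (hsgn.1 hp)]
      · have hp' := fun h' => hp (hsgn.2 h')
        rw [abs_of_neg (not_le.1 hp), abs_of_neg (not_le.1 hp'), abs_sub_comm]
        congr 1; ring
    rw [← mul_sub, abs_mul, abs_of_pos (by positivity), ← h4] at h3
    rw [div_le_iff₀ (by positivity)] at h1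
    nlinarith
  -- Distances are at most `1/2`, so the index never exceeds `Q`.
  have hsub : s.image key ⊆ Finset.univ ×ˢ Finset.range (Q + 1) := by
    intro x hx
    obtain ⟨i, -, rfl⟩ := Finset.mem_image.1 hx
    simp only [key, Finset.mem_product, Finset.mem_univ, true_and, Finset.mem_range, Nat.lt_succ_iff]
    refine Nat.floor_le_of_le ?_
    nlinarith [distInt_le_half (θ i)]
  calc ∑ i ∈ s, w i ≤ ∑ i ∈ s, h (key i).2 := Finset.sum_le_sum hle
    _ = ∑ x ∈ s.image key, h x.2 := by rw [Finset.sum_image hinj]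
    _ ≤ ∑ x ∈ (Finset.univ : Finset Bool) ×ˢ Finset.range (Q + 1), h x.2 :=
        Finset.sum_le_sum_of_subset_of_nonneg hsub (fun x _ _ => hh _)
    _ = 2 * ∑ j ∈ Finset.range (Q + 1), h j := by
        rw [Finset.sum_product]; simp
    _ = 2 * (Y + ∑ j ∈ Finset.Icc 1 Q, 2 * Q * (1 / (j : ℝ))) := by
        congr 1
        rw [Finset.sum_range_succ', add_comm]
        congr 1
        rw [← Finset.Ico_add_one_right_eq_Icc, Finset.sum_Ico_eq_sum_range]
        refine Finset.sum_congr (by simp) fun j _ => ?_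
        simp [h, add_comm]
    _ ≤ 2 * Y + 4 * Q * (1 + Real.log Q) := by
        rw [← Finset.mul_sum]
        nlinarith [sum_one_div_le_one_add_log Q]

/-- `q` does not divide `a * d`, so `a * d / q` is at least `1/q` from every integer; replacing
`a/q` by `α` moves it by at most `d/q² ≤ 1/(2q)`. -/
theorem inv_le_distInt_mul (α : ℝ) (a : ℤ) (q : ℕ) (hq : 0 < q) (hg : Int.gcd a q = 1)
    (hα : |α - a / q| ≤ 1 / (q : ℝ) ^ 2) (d : ℕ) (hd : 0 < d) (hdq : d ≤ q / 2) :
    1 / (2 * q : ℝ) ≤ distInt (α * d) := by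
  have hq' : (0 : ℝ) < q := by exact_mod_cast hq
  rw [distInt_eq]
  set n := round (α * d)
  have hne : a * d - n * q ≠ 0 := by
    intro h
    have h1 : (q : ℤ) ∣ a * d := ⟨n, by linarith⟩
    have h2 : (q : ℤ) ∣ d := Int.dvd_of_dvd_mul_right_of_gcd_one h1 (by rwa [Int.gcd_comm])
    have h3 := Nat.le_of_dvd hd (Int.natCast_dvd_natCast.1 h2)
    omega
  have h1 : (1 : ℝ) ≤ |(a * d - n * q : ℝ)| := by
    exact_mod_cast Int.one_le_abs hne
  have h2 : (a * d - n * q : ℝ) = q * (α * d - n) - q * d * (α - a / q) := by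
    field_simp; ring
  have h3 : (2 * d : ℝ) ≤ q := by exact_mod_cast (by omega : 2 * d ≤ q)
  have h4 : |q * d * (α - a / q)| ≤ 1 / 2 := by
    rw [abs_mul, abs_of_nonneg (by positivity)]
    calc (q * d : ℝ) * |α - a / q| ≤ q * d * (1 / q ^ 2) := by gcongr
      _ = d / q := by field_simp
      _ ≤ 1 / 2 := by rw [div_le_div_iff₀ hq' (by norm_num)]; linarith
  have h5 : |q * (α * d - n)| ≥ 1 / 2 := by
    have := abs_sub (q * (α * d - n)) (q * d * (α - a / q))
    rw [h2] at h1
    linarith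
  rw [abs_mul, abs_of_pos hq'] at h5
  rw [div_le_iff₀ (by positivity)]
  linarith

theorem sum_block_le (α : ℝ) (a : ℤ) (q : ℕ) (hq : 0 < q) (hg : Int.gcd a q = 1)
    (hα : |α - a / q| ≤ 1 / (q : ℝ) ^ 2) (β : ℝ) (s : Finset ℕ)
    (hs : ∀ i ∈ s, ∀ j ∈ s, i ≤ j + q / 2) (w : ℕ → ℝ) (Y : ℝ)
    (hY : 0 ≤ Y) (hwY : ∀ i ∈ s, w i ≤ Y) (hw : ∀ i ∈ s, w i * distInt (α * i + β) ≤ 1) :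
    ∑ i ∈ s, w i ≤ 2 * Y + 4 * q * (1 + Real.log q) := by
  refine sum_le_of_spaced s (fun i => α * i + β) w q hq Y hY hwY hw ?_
  have key : ∀ i ∈ s, ∀ j ∈ s, i < j → 1 / (2 * q : ℝ) ≤ distInt (α * j + β - (α * i + β)) := by
    intro i hi j hj hij
    have := inv_le_distInt_mul α a q hq hg hα (j - i) (by omega) (by have := hs j hj i hi; omega)
    rw [Nat.cast_sub hij.le] at this
    convert this using 2
    ring
  intro i hi j hj hij
  rcases lt_or_gt_of_ne hij with h | h
  · have := key i hi j hj h
    rwa [distInt, ← norm_neg, ← AddCircle.coe_neg, neg_sub] at this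
  · exact key j hj i hi h

/-- The interval is cut into blocks of length `q / 2 + 1`, the longest on which `inv_le_distInt_mul`
guarantees spacing. -/
theorem sum_Ico_le (α : ℝ) (a : ℤ) (q : ℕ) (hq : 0 < q) (hg : Int.gcd a q = 1)
    (hα : |α - a / q| ≤ 1 / (q : ℝ) ^ 2) (β : ℝ) (m n : ℕ) (w : ℕ → ℝ) (Y : ℝ)
    (hY : 0 ≤ Y) (hwY : ∀ i ∈ Finset.Ico m (m + n), w i ≤ Y)
    (hw : ∀ i ∈ Finset.Ico m (m + n), w i * distInt (α * i + β) ≤ 1) :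
    ∑ i ∈ Finset.Ico m (m + n), w i ≤ (2 * n / q + 1) * (2 * Y + 4 * q * (1 + Real.log q)) := by
  set h := q / 2 + 1 with hh
  have hq' : (0 : ℝ) < q := by exact_mod_cast hq
  have hlog : 0 ≤ Real.log q := Real.log_natCast_nonneg q
  have hmaps : ∀ i ∈ Finset.Ico m (m + n), (i - m) / h ∈ Finset.range (n / h + 1) := by
    intro i hi
    rw [Finset.mem_Ico] at hi
    rw [Finset.mem_range, Nat.lt_succ_iff]
    exact Nat.div_le_div_right (by omega)
  rw [← Finset.sum_fiberwise_of_maps_to hmaps]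
  calc _ ≤ ∑ _j ∈ Finset.range (n / h + 1), (2 * Y + 4 * q * (1 + Real.log q)) := by
        refine Finset.sum_le_sum fun k _ => ?_
        refine sum_block_le α a q hq hg hα β _ ?_ w Y hY ?_ ?_
        · intro i hi j hj
          simp only [Finset.mem_filter, Finset.mem_Ico] at hi hj
          have h1 := Nat.div_add_mod (i - m) h
          have h2 := Nat.div_add_mod (j - m) h
          have h3 := Nat.mod_lt (i - m) (y := h) (by omega)
          rw [hi.2] at h1
          rw [hj.2] at h2
          omega
        · exact fun i hi => hwY i (Finset.mem_filter.1 hi).1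
        · exact fun i hi => hw i (Finset.mem_filter.1 hi).1
    _ = ((n / h : ℕ) + 1) * (2 * Y + 4 * q * (1 + Real.log q)) := by
          rw [Finset.sum_const, Finset.card_range, nsmul_eq_mul, Nat.cast_add, Nat.cast_one]
    _ ≤ _ := by
        gcongr
        refine Nat.cast_div_le.trans ?_
        rw [div_le_div_iff₀ (by positivity) hq']
        have : (q : ℝ) ≤ 2 * h := by exact_mod_cast (by omega : q ≤ 2 * h)
        nlinarith [(Nat.cast_nonneg n : (0 : ℝ) ≤ n)]

/-- Same blocks, but the cap `M / r` decreases from block to block, so the caps add up to a harmonic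
sum. In the block at the origin the cap is useless; there `distInt (α * r) ≥ 1/(2q)` gives `w r ≤
2q` instead. -/
theorem sum_typeOne_le (α : ℝ) (a : ℤ) (q : ℕ) (hq : 0 < q) (hg : Int.gcd a q = 1)
    (hα : |α - a / q| ≤ 1 / (q : ℝ) ^ 2) (M R : ℕ) (hqM : q ≤ M) (hRM : R ≤ M) (w : ℕ → ℝ)
    (hwY : ∀ r ∈ Finset.Icc 1 R, w r ≤ M / r)
    (hw : ∀ r ∈ Finset.Icc 1 R, w r * distInt (α * r) ≤ 1) :
    ∑ r ∈ Finset.Icc 1 R, w r ≤ 8 * (M / q + R + q) * (1 + Real.log M) := by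
  set h := q / 2 + 1 with hh
  have hq' : (0 : ℝ) < q := by exact_mod_cast hq
  have hlog : 0 ≤ Real.log q := Real.log_natCast_nonneg q
  have hh' : (q : ℝ) ≤ 2 * h := by exact_mod_cast (by omega : q ≤ 2 * h)
  have hh0 : (0 : ℝ) < h := by positivity
  have hlM : Real.log q ≤ Real.log M := Real.log_le_log hq' (by exact_mod_cast hqM)
  have hM : (0 : ℝ) ≤ M := Nat.cast_nonneg _
  have hmaps : ∀ i ∈ Finset.Icc 1 R, i / h ∈ Finset.range (R / h + 1) := by
    intro i hi
    rw [Finset.mem_Icc] at hi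
    rw [Finset.mem_range, Nat.lt_succ_iff]
    exact Nat.div_le_div_right hi.2
  have hblock : ∀ k, ∀ i ∈ (Finset.Icc 1 R).filter (fun i => i / h = k),
      ∀ j ∈ (Finset.Icc 1 R).filter (fun i => i / h = k), i ≤ j + q / 2 := by
    intro k i hi j hj
    simp only [Finset.mem_filter] at hi hj
    have h1 := Nat.div_add_mod i h
    have h2 := Nat.div_add_mod j h
    have h3 := Nat.mod_lt i (y := h) (by omega)
    rw [hi.2] at h1
    rw [hj.2] at h2
    omega
  have hw' : ∀ k, ∀ i ∈ (Finset.Icc 1 R).filter (fun i => i / h = k),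
      w i * distInt (α * i + 0) ≤ 1 := by
    intro k i hi
    rw [add_zero]
    exact hw i (Finset.mem_filter.1 hi).1
  rw [← Finset.sum_fiberwise_of_maps_to hmaps, Finset.sum_range_succ']
  have hzero : ∑ i ∈ (Finset.Icc 1 R).filter (fun i => i / h = 0), w i
      ≤ 2 * (2 * q) + 4 * q * (1 + Real.log q) := by
    refine sum_block_le α a q hq hg hα 0 _ (hblock 0) w (2 * q) (by positivity) ?_ (hw' 0)
    intro i hi
    have h0 := hw' 0 i hi
    simp only [Finset.mem_filter, Finset.mem_Icc] at hi
    have h1 := Nat.div_add_mod i h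
    have h3 := Nat.mod_lt i (y := h) (by omega)
    rw [hi.2] at h1
    have h4 := inv_le_distInt_mul α a q hq hg hα i (by omega) (by omega)
    rw [add_zero] at h0
    rcases le_or_gt (w i) 0 with hneg | hpos
    · linarith
    · rw [div_le_iff₀ (by positivity)] at h4
      nlinarith
  have hpos : ∀ k ∈ Finset.range (R / h),
      ∑ i ∈ (Finset.Icc 1 R).filter (fun i => i / h = k + 1), w i
      ≤ 2 * (M / h * (1 / ((k + 1 : ℕ) : ℝ))) + 4 * q * (1 + Real.log q) := by
    intro k _
    refine sum_block_le α a q hq hg hα 0 _ (hblock _) w _ (by positivity) ?_ (hw' _)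
    intro i hi
    simp only [Finset.mem_filter] at hi
    refine (hwY i hi.1).trans ?_
    rw [mul_one_div, div_div]
    refine div_le_div_of_nonneg_left hM (by positivity) ?_
    have h1 := Nat.div_mul_le_self i h
    rw [hi.2, mul_comm] at h1
    exact_mod_cast h1
  have hharm : ∑ k ∈ Finset.range (R / h), 1 / ((k + 1 : ℕ) : ℝ) ≤ 1 + Real.log M := by
    have h1 := sum_one_div_le_one_add_log (R / h)
    rw [← Finset.Ico_add_one_right_eq_Icc, Finset.sum_Ico_eq_sum_range] at h1
    have h2 : Real.log (R / h : ℕ) ≤ Real.log M := by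
      rcases Nat.eq_zero_or_pos (R / h) with h0 | h0
      · rw [h0]; simpa using Real.log_natCast_nonneg M
      · refine Real.log_le_log (by exact_mod_cast h0) ?_
        exact_mod_cast (Nat.div_le_self R h).trans hRM
    refine le_trans (le_of_eq ?_) (h1.trans (by linarith))
    refine Finset.sum_congr (by simp) fun k _ => by rw [add_comm]
  have hJ : ((R / h : ℕ) : ℝ) * q ≤ 2 * R := by
    have h1 : ((R / h : ℕ) : ℝ) * h ≤ R := by exact_mod_cast Nat.div_mul_le_self R h
    nlinarith [(Nat.cast_nonneg (R / h) : (0 : ℝ) ≤ _)]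
  have hMh : (M : ℝ) / h ≤ 2 * (M / q) := by
    rw [mul_div_assoc', div_le_div_iff₀ hh0 hq']
    nlinarith
  have hsum := Finset.sum_le_sum hpos
  rw [Finset.sum_add_distrib, ← Finset.mul_sum, ← Finset.mul_sum, Finset.sum_const,
    Finset.card_range, nsmul_eq_mul] at hsum
  set Λ := 1 + Real.log M with hΛ
  have hΛ1 : 1 ≤ Λ := by linarith
  have e1 : (M : ℝ) / h * ∑ k ∈ Finset.range (R / h), 1 / ((k + 1 : ℕ) : ℝ) ≤ 2 * (M / q) * Λ :=
    mul_le_mul hMh hharm (Finset.sum_nonneg fun _ _ => by positivity) (by positivity)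
  have e2 : ((R / h : ℕ) : ℝ) * (4 * q * (1 + Real.log q)) ≤ 8 * R * Λ := by
    calc ((R / h : ℕ) : ℝ) * (4 * q * (1 + Real.log q))
        = 4 * (((R / h : ℕ) : ℝ) * q) * (1 + Real.log q) := by ring
      _ ≤ 4 * (2 * R) * Λ := by gcongr; linarith
      _ = _ := by ring
  have e3 : 4 * (q : ℝ) * (1 + Real.log q) ≤ 4 * q * Λ := by gcongr; linarith
  have e4 : (0 : ℝ) ≤ M / q * Λ := by positivity
  nlinarith

/-! ### Removing a triangular condition from a bilinear form. -/

/-- A Rademacher–Menshov type inequality: a triangular condition `ψ b ≤ φ a` on a bilinear form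
costs a factor that is logarithmic in the length of the range of `φ`. -/
theorem sum_norm_sq_triangular_le {ι κ : Type*} (B : Finset κ) (v : ι → κ → ℂ) (φ : ι → ℕ)
    (ψ : κ → ℕ) (K : ℕ) (s : ℕ) (A : Finset ι) (hA : ∀ a ∈ A, s ≤ φ a ∧ φ a < s + 2 ^ K) :
    ∑ b ∈ B, ‖∑ a ∈ A with ψ b ≤ φ a, v a b‖ ^ 2
      ≤ ((K : ℝ) + 1) ^ 2 *
        ∑ a ∈ A, ∑ a' ∈ A, ‖∑ b ∈ B, v a b * (starRingEnd ℂ) (v a' b)‖ := by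
  classical
  -- `G` dominates the unrestricted quadratic form and, as a double sum of nonnegative terms, is
  -- superadditive over disjoint sets; the induction uses only these two facts.
  set G : Finset ι → ℝ :=
    fun A => ∑ a ∈ A, ∑ a' ∈ A, ‖∑ b ∈ B, v a b * (starRingEnd ℂ) (v a' b)‖ with hG
  have hfull : ∀ A : Finset ι, ∑ b ∈ B, ‖∑ a ∈ A, v a b‖ ^ 2 ≤ G A := by
    intro A
    have h1 : ((∑ b ∈ B, ‖∑ a ∈ A, v a b‖ ^ 2 : ℝ) : ℂ)
        = ∑ a ∈ A, ∑ a' ∈ A, ∑ b ∈ B, v a b * (starRingEnd ℂ) (v a' b) := by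
      push_cast
      rw [Finset.sum_congr rfl fun b _ => (Complex.mul_conj' (∑ a ∈ A, v a b)).symm]
      simp only [map_sum, Finset.sum_mul_sum]
      rw [Finset.sum_comm]
      refine Finset.sum_congr rfl fun a _ => Finset.sum_comm
    have h2 : ∑ b ∈ B, ‖∑ a ∈ A, v a b‖ ^ 2
        = ‖((∑ b ∈ B, ‖∑ a ∈ A, v a b‖ ^ 2 : ℝ) : ℂ)‖ := by
      rw [Complex.norm_real, Real.norm_of_nonneg (by positivity)]
    rw [h2, h1]
    refine (norm_sum_le _ _).trans (Finset.sum_le_sum fun a _ => norm_sum_le _ _)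
  have hGnn : ∀ A, 0 ≤ G A := fun A => by simp only [hG]; positivity
  have hGadd : ∀ A₁ A₂ : Finset ι, Disjoint A₁ A₂ → G A₁ + G A₂ ≤ G (A₁ ∪ A₂) := by
    intro A₁ A₂ hd
    simp only [hG]
    rw [Finset.sum_union hd]
    gcongr
    · exact Finset.subset_union_left
    · exact Finset.subset_union_right
  change _ ≤ _ * G A
  induction K generalizing s A with
  | zero =>
    have hφ : ∀ a ∈ A, φ a = s := fun a ha => by have := hA a ha; simp at this; omega
    refine (Finset.sum_le_sum fun b _ => ?_).trans ((hfull A).trans (by simp))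
    by_cases hb : ψ b ≤ s
    · rw [Finset.filter_true_of_mem fun a ha => by rw [hφ a ha]; exact hb]
    · rw [Finset.filter_false_of_mem fun a ha => by rw [hφ a ha]; exact hb]
      simp
  | succ K ih =>
    set A₁ := A.filter fun a => φ a < s + 2 ^ K with hA₁
    set A₂ := A.filter fun a => ¬ φ a < s + 2 ^ K with hA₂
    have hdis : Disjoint A₁ A₂ := Finset.disjoint_filter_filter_not _ _ _
    have hun : A₁ ∪ A₂ = A := Finset.filter_union_filter_not_eq _ _
    have ih1 := ih s A₁ fun a ha => by
      have h := Finset.mem_filter.1 ha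
      exact ⟨(hA a h.1).1, h.2⟩
    have ih2 := ih (s + 2 ^ K) A₂ fun a ha => by
      have h := Finset.mem_filter.1 ha
      refine ⟨not_lt.1 h.2, ?_⟩
      have := (hA a h.1).2
      rw [pow_succ] at this
      omega
    have hadd := hGadd A₁ A₂ hdis
    rw [hun] at hadd
    have hk : (0 : ℝ) < (K : ℝ) + 1 := by positivity
    -- Bisect the range of `φ`. If `ψ b` is at most the midpoint, the upper half is summed in full;
    -- otherwise the lower half drops out. The Cauchy weights `1 + 1/(K+1)` and `K + 2` make both
    -- halves cost at most `(K+2)²`.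
    have hpt : ∀ b ∈ B, ‖∑ a ∈ A with ψ b ≤ φ a, v a b‖ ^ 2
        ≤ (1 + 1 / ((K : ℝ) + 1)) * ‖∑ a ∈ A₁ with ψ b ≤ φ a, v a b‖ ^ 2
          + ((K : ℝ) + 2) * ‖∑ a ∈ A₂, v a b‖ ^ 2
          + ‖∑ a ∈ A₂ with ψ b ≤ φ a, v a b‖ ^ 2 := by
      intro b _
      have hsplit : ∑ a ∈ A with ψ b ≤ φ a, v a b
          = ∑ a ∈ A₁ with ψ b ≤ φ a, v a b + ∑ a ∈ A₂ with ψ b ≤ φ a, v a b := by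
        rw [← hun, Finset.filter_union, Finset.sum_union]
        exact Finset.disjoint_filter_filter hdis
      by_cases hb : ψ b ≤ s + 2 ^ K
      · have h2 : A₂.filter (fun a => ψ b ≤ φ a) = A₂ := by
          refine Finset.filter_true_of_mem fun a ha => ?_
          have h := (Finset.mem_filter.1 ha).2
          omega
        rw [hsplit, h2]
        set x := ∑ a ∈ A₁ with ψ b ≤ φ a, v a b
        set y := ∑ a ∈ A₂, v a b
        have h3 : ‖x + y‖ ^ 2 ≤ (‖x‖ + ‖y‖) ^ 2 := by gcongr; exact norm_add_le _ _
        have h4 : (‖x‖ + ‖y‖) ^ 2 ≤ (1 + 1 / ((K : ℝ) + 1)) * ‖x‖ ^ 2 + ((K : ℝ) + 2) * ‖y‖ ^ 2 := by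
          have h5 : (1 + 1 / ((K : ℝ) + 1)) * ‖x‖ ^ 2 + ((K : ℝ) + 2) * ‖y‖ ^ 2 - (‖x‖ + ‖y‖) ^ 2
            = (‖x‖ - ((K : ℝ) + 1) * ‖y‖) ^ 2 / ((K : ℝ) + 1) := by field_simp; ring
          have h6 : 0 ≤ (‖x‖ - ((K : ℝ) + 1) * ‖y‖) ^ 2 / ((K : ℝ) + 1) := by positivity
          linarith
        have h7 : 0 ≤ ‖y‖ ^ 2 := by positivity
        linarith
      · have h1 : A₁.filter (fun a => ψ b ≤ φ a) = ∅ := by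
          refine Finset.filter_false_of_mem fun a ha => ?_
          have h := (Finset.mem_filter.1 ha).2
          omega
        rw [hsplit, h1, Finset.sum_empty, zero_add]
        have h7 : 0 ≤ ((K : ℝ) + 2) * ‖∑ a ∈ A₂, v a b‖ ^ 2 := by positivity
        simpa using h7
    have hsum := Finset.sum_le_sum hpt
    rw [Finset.sum_add_distrib, Finset.sum_add_distrib, ← Finset.mul_sum, ← Finset.mul_sum] at hsum
    have h1 : (1 + 1 / ((K : ℝ) + 1)) * ∑ b ∈ B, ‖∑ a ∈ A₁ with ψ b ≤ φ a, v a b‖ ^ 2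
        ≤ ((K : ℝ) + 2) * ((K : ℝ) + 1) * G A₁ := by
      calc _ ≤ (1 + 1 / ((K : ℝ) + 1)) * (((K : ℝ) + 1) ^ 2 * G A₁) := by gcongr
        _ = _ := by field_simp; ring
    have h2 : ((K : ℝ) + 2) * ∑ b ∈ B, ‖∑ a ∈ A₂, v a b‖ ^ 2 ≤ ((K : ℝ) + 2) * G A₂ := by
      gcongr; exact hfull A₂
    have h3 : ((K : ℝ) + 2) ^ 2 * (G A₁ + G A₂) ≤ ((K : ℝ) + 2) ^ 2 * G A := by gcongr
    have hK0 : (0 : ℝ) ≤ K := Nat.cast_nonneg K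
    push_cast
    nlinarith [hGnn A₁, hGnn A₂, mul_nonneg hK0 (hGnn A₁), mul_nonneg hK0 (hGnn A₂)]

/-! ### Factorizations by largest prime factors. -/

/-- The largest prime factor of `n` (`0` if there is none). -/
def maxFac (n : ℕ) : ℕ := n.primeFactors.sup id

theorem maxFac_le_iff {n m : ℕ} (hn : n ≠ 0) :
    maxFac n ≤ m ↔ ∀ p : ℕ, p.Prime → p ∣ n → p ≤ m := by
  simp only [maxFac, Finset.sup_le_iff, Nat.mem_primeFactors, id]
  exact ⟨fun h p hp hd => h p ⟨hp, hd, hn⟩, fun h p hp => h p hp.1 hp.2.1⟩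

/-- Two divisors of `n`, each consisting of the largest prime factors of `n`, are comparable. -/
theorem dvd_or_dvd_of_maxFac_le_minFac {a b a' b' : ℕ} (ha : a ≠ 0) (hb : b ≠ 0) (ha' : a' ≠ 0)
    (hb' : b' ≠ 0) (h : a * b = a' * b') (hab : maxFac b ≤ a.minFac) (hab' : maxFac b' ≤ a'.minFac) :
    a ∣ a' ∨ a' ∣ a := by
  rw [maxFac_le_iff hb] at hab
  rw [maxFac_le_iff hb'] at hab'
  -- The divisor with the larger least prime divides the other, ties being broken by the exponent of
  -- that prime. A prime of `a` not dividing `b'` has its full power in `a'`; one dividing `b'` must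
  -- equal both least primes.
  have key : ∀ {a b a' b' : ℕ}, a ≠ 0 → b ≠ 0 → a' ≠ 0 → b' ≠ 0 → a * b = a' * b' →
      (∀ p : ℕ, p.Prime → p ∣ b' → p ≤ a'.minFac) → a'.minFac ≤ a.minFac →
      (a'.minFac = a.minFac → a.factorization a.minFac ≤ a'.factorization a.minFac) → a ∣ a' := by
    intro a b a' b' ha hb ha' hb' h hab' hle hval
    rw [← Nat.factorization_prime_le_iff_dvd ha ha']
    intro p hp
    by_cases hpa : p ∣ a
    · have h1 : a.minFac ≤ p := Nat.minFac_le_of_dvd hp.two_le hpa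
      by_cases hpb : p ∣ b'
      · have h2 := hab' p hp hpb
        have h3 : p = a.minFac := by omega
        rw [h3]
        exact hval (by omega)
      · have h2 := congrArg (fun n => n.factorization p) h
        simp only [Nat.factorization_mul ha hb, Nat.factorization_mul ha' hb', Finsupp.add_apply,
          Nat.factorization_eq_zero_of_not_dvd hpb] at h2
        omega
    · rw [Nat.factorization_eq_zero_of_not_dvd hpa]; exact Nat.zero_le _
  rcases lt_trichotomy a.minFac a'.minFac with hlt | heq | hgt
  · exact Or.inr (key ha' hb' ha hb h.symm hab hlt.le fun h => by omega)
  · rcases le_total (a.factorization a.minFac) (a'.factorization a.minFac) with h1 | h1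
    · exact Or.inl (key ha hb ha' hb' h hab' heq.ge fun _ => h1)
    · exact Or.inr (key ha' hb' ha hb h.symm hab heq.le fun _ => by rwa [← heq])
  · exact Or.inl (key ha hb ha' hb' h hab' hgt.le fun h => by omega)

/-- Write `a' = a * c`. The primes of `c` divide `b`, so the least prime of `a'` comes from `c` and
removing it leaves a multiple of `a`. Hence two distinct candidates cannot both be shortest above
`U`. -/
theorem le_div_minFac_of_dvd {a b a' b' : ℕ} (ha : a ≠ 0) (hb : b ≠ 0) (ha' : a' ≠ 0)
    (h : a * b = a' * b') (hab : maxFac b ≤ a.minFac) (hd : a ∣ a') (hne : a ≠ a') :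
    a ≤ a' / a'.minFac := by
  rw [maxFac_le_iff hb] at hab
  obtain ⟨c, rfl⟩ := hd
  have hc0 : c ≠ 0 := by rintro rfl; simp at ha'
  have hc1 : c ≠ 1 := by rintro rfl; simp at hne
  have hcb : b = c * b' := by
    rw [mul_assoc] at h
    exact Nat.eq_of_mul_eq_mul_left (Nat.pos_of_ne_zero ha) h
  have hcp := Nat.minFac_prime hc1
  have h1 : c.minFac ≤ a.minFac :=
    hab _ hcp (hcb ▸ (Nat.minFac_dvd c).mul_right b')
  have hac1 : a * c ≠ 1 := by
    intro h
    exact hc1 (Nat.eq_one_of_mul_eq_one_left h)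
  have h2 : (a * c).minFac = c.minFac := by
    refine le_antisymm (Nat.minFac_le_of_dvd hcp.two_le ((Nat.minFac_dvd c).mul_left a)) ?_
    have hp := Nat.minFac_prime hac1
    rcases (hp.dvd_mul).1 (Nat.minFac_dvd (a * c)) with h3 | h3
    · exact h1.trans (Nat.minFac_le_of_dvd hp.two_le h3)
    · exact Nat.minFac_le_of_dvd hp.two_le h3
  rw [h2, Nat.mul_div_assoc _ (Nat.minFac_dvd c)]
  exact Nat.le_mul_of_pos_right _ (Nat.div_pos (Nat.minFac_le (Nat.pos_of_ne_zero hc0)) hcp.pos)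

/-- Every `n > U` splits uniquely as `n = a * b` where `a` is the shortest product of the largest
prime factors of `n` that exceeds `U`. -/
theorem existsUnique_mul_eq (U n : ℕ) (hU : 0 < U) (hn : U < n) :
    ∃! x : ℕ × ℕ, x.1 * x.2 = n ∧ U < x.1 ∧ x.1 / x.1.minFac ≤ U ∧ maxFac x.2 ≤ x.1.minFac := by
  classical
  have hn0 : n ≠ 0 := by omega
  have hex : ∃ a, U < a ∧ ∃ b, a * b = n ∧ maxFac b ≤ a.minFac :=
    ⟨n, hn, 1, by simp, by simp [maxFac]⟩
  obtain ⟨hUa, b, hab, hmax⟩ := Nat.find_spec hex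
  set a := Nat.find hex with ha
  have hmin := fun m (hm : m < a) => Nat.find_min hex hm
  have ha1 : a ≠ 1 := by omega
  have hb0 : b ≠ 0 := by rintro rfl; simp at hab; omega
  have hp := Nat.minFac_prime ha1
  refine ⟨(a, b), ⟨hab, hUa, ?_, hmax⟩, ?_⟩
  · by_contra! hcon
    refine hmin (a / a.minFac) (Nat.div_lt_self (by omega) hp.one_lt) ⟨hcon, a.minFac * b, ?_, ?_⟩
    · rw [← mul_assoc, Nat.div_mul_cancel (Nat.minFac_dvd a), hab]
    · rw [maxFac_le_iff (mul_ne_zero hp.ne_zero hb0)]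
      intro p hpp hpd
      have h1 : a / a.minFac ≠ 1 := by simp only at hcon; omega
      have h2 : a.minFac ≤ (a / a.minFac).minFac :=
        Nat.minFac_le_of_dvd (Nat.minFac_prime h1).two_le
          ((Nat.minFac_dvd _).trans (Nat.div_dvd_of_dvd (Nat.minFac_dvd a)))
      refine le_trans ?_ h2
      rcases hpp.dvd_mul.1 hpd with h3 | h3
      · exact Nat.le_of_dvd hp.pos h3
      · exact (maxFac_le_iff hb0).1 hmax p hpp h3
  · rintro ⟨a', b'⟩ ⟨hab', hUa', hdiv', hmax'⟩
    simp only at hab' hUa' hdiv' hmax'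
    have hb0' : b' ≠ 0 := by rintro rfl; simp at hab'; omega
    have heq : a' = a := by
      by_contra hne
      rcases dvd_or_dvd_of_maxFac_le_minFac (by omega) hb0' (by omega) hb0 (hab'.trans hab.symm)
        hmax' hmax with h | h
      · have := Nat.le_of_dvd (by omega) h
        exact hmin a' (by omega) ⟨hUa', b', hab', hmax'⟩
      · have := le_div_minFac_of_dvd (by omega) hb0 (by omega)
          (hab.trans hab'.symm) hmax h (Ne.symm hne)
        omega
    rw [heq] at hab'
    rw [heq, Nat.eq_of_mul_eq_mul_left (by omega : 0 < a) (hab'.trans hab.symm)]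

/-! ### Linear and bilinear exponential sums. -/

/-- The part of `∑_{n ≤ M} e(αn)` supported on the multiples of `r`. -/
noncomputable def multipleSum (α : ℝ) (M r : ℕ) : ℂ :=
  ∑ n ∈ Finset.Icc 1 M with r ∣ n, expTwoPi (α * n)

theorem multipleSum_eq (α : ℝ) (M r : ℕ) (hr : 0 < r) :
    multipleSum α M r = ∑ m ∈ Finset.Icc 1 (M / r), expTwoPi (α * r * m) := by
  symm
  refine Finset.sum_nbij (fun m => r * m) ?_ ?_ ?_ ?_
  · intro m hm
    rw [Finset.mem_Icc] at hm
    rw [Finset.mem_filter, Finset.mem_Icc]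
    refine ⟨⟨Nat.mul_pos hr hm.1, ?_⟩, Dvd.intro _ rfl⟩
    rw [mul_comm]
    exact (Nat.le_div_iff_mul_le hr).1 hm.2
  · intro x _ y _ h
    exact Nat.eq_of_mul_eq_mul_left hr h
  · intro n hn
    simp only [Finset.coe_filter, Finset.mem_Icc, Set.mem_ofPred_eq] at hn
    obtain ⟨⟨h1, h2⟩, m, rfl⟩ := hn
    refine ⟨m, ?_, rfl⟩
    rw [Finset.mem_coe, Finset.mem_Icc]
    exact ⟨Nat.pos_of_mul_pos_left h1, (Nat.le_div_iff_mul_le hr).2 (by rwa [mul_comm])⟩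
  · intro m _
    push_cast
    rw [mul_assoc]

theorem norm_multipleSum_le (α : ℝ) (M r : ℕ) (hr : 0 < r) :
    ‖multipleSum α M r‖ ≤ M / r := by
  rw [multipleSum_eq α M r hr]
  exact (norm_sum_expTwoPi_le _ _).trans Nat.cast_div_le

theorem norm_multipleSum_mul_distInt_le (α : ℝ) (M r : ℕ) (hr : 0 < r) :
    ‖multipleSum α M r‖ * distInt (α * r) ≤ 1 := by
  rw [multipleSum_eq α M r hr]
  exact norm_sum_expTwoPi_mul_distInt_le _ _

theorem sum_norm_multipleSum_le (α : ℝ) (a : ℤ) (q : ℕ) (hq : 0 < q) (hg : Int.gcd a q = 1)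
    (hα : |α - a / q| ≤ 1 / (q : ℝ) ^ 2) (M R : ℕ) (hqM : q ≤ M) (hRM : R ≤ M) :
    ∑ r ∈ Finset.Icc 1 R, ‖multipleSum α M r‖ ≤ 8 * (M / q + R + q) * (1 + Real.log M) :=
  sum_typeOne_le α a q hq hg hα M R hqM hRM _
    (fun r hr => norm_multipleSum_le α M r (Finset.mem_Icc.1 hr).1)
    (fun r hr => norm_multipleSum_mul_distInt_le α M r (Finset.mem_Icc.1 hr).1)

/-- Cauchy–Schwarz over `b`, then `sum_norm_sq_triangular_le`. The correlation of `x` and `y` is a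
geometric sum with frequency `α(x - y)`, so each row is summed by `sum_Ico_le` with shift `-(α *
y)`. -/
theorem norm_sum_bilinear_sq_le (α : ℝ) (a : ℤ) (q : ℕ) (hq : 0 < q) (hg : Int.gcd a q = 1)
    (hα : |α - a / q| ≤ 1 / (q : ℝ) ^ 2) (M N : ℕ) (hN : 0 < N) (A : Finset ℕ)
    (hA : ∀ x ∈ A, N ≤ x ∧ x < N + N) (φ ψ : ℕ → ℕ) (K : ℕ) (hφ : ∀ x ∈ A, φ x < 2 ^ K) :
    ‖∑ x ∈ A, ∑ b ∈ Finset.Icc 1 (M / x) with ψ b ≤ φ x, expTwoPi (α * (x * b : ℕ))‖ ^ 2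
      ≤ M * ((K : ℝ) + 1) ^ 2 *
        ((2 * N / q + 1) * (2 * (M / N) + 4 * q * (1 + Real.log q))) := by
  classical
  have hq' : (0 : ℝ) < q := by exact_mod_cast hq
  have hN' : (0 : ℝ) < N := by exact_mod_cast hN
  have hlog : 0 ≤ Real.log q := Real.log_natCast_nonneg q
  set B := Finset.Icc 1 (M / N) with hB
  -- Extension by zero makes the range of `b` independent of `x`.
  let v : ℕ → ℕ → ℂ := fun x b => if b ≤ M / x then expTwoPi (α * (x * b : ℕ)) else 0
  have hdiv : ∀ x ∈ A, M / x ≤ M / N := fun x hx => Nat.div_le_div_left (hA x hx).1 hN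
  have hrew : ∑ x ∈ A, ∑ b ∈ Finset.Icc 1 (M / x) with ψ b ≤ φ x, expTwoPi (α * (x * b : ℕ))
      = ∑ b ∈ B, ∑ x ∈ A with ψ b ≤ φ x, v x b := by
    simp only [Finset.sum_filter]
    rw [Finset.sum_comm (s := B)]
    refine Finset.sum_congr rfl fun x hx => ?_
    rw [← Finset.sum_subset (Finset.Icc_subset_Icc_right (hdiv x hx) : Finset.Icc 1 (M / x) ⊆ B)]
    · refine Finset.sum_congr rfl fun b hb => ?_
      simp only [v]
      rw [if_pos (Finset.mem_Icc.1 hb).2]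
    · intro b hb hb'
      have h1 : ¬ b ≤ M / x := fun h => hb' (Finset.mem_Icc.2 ⟨(Finset.mem_Icc.1 hb).1, h⟩)
      simp [v, h1]
  have hcorr : ∀ x ∈ A, ∀ y ∈ A, ∑ b ∈ B, v x b * (starRingEnd ℂ) (v y b)
      = ∑ b ∈ Finset.Icc 1 (min (M / x) (M / y)), expTwoPi ((α * x + -(α * y)) * b) := by
    intro x hx y _
    rw [← Finset.sum_subset (Finset.Icc_subset_Icc_right ((min_le_left _ _).trans (hdiv x hx)) :
      Finset.Icc 1 (min (M / x) (M / y)) ⊆ B)]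
    · refine Finset.sum_congr rfl fun b hb => ?_
      have h := le_min_iff.1 (Finset.mem_Icc.1 hb).2
      simp only [v]
      rw [if_pos h.1, if_pos h.2, conj_expTwoPi, ← expTwoPi_add]
      congr 1
      push_cast
      ring
    · intro b hb hb'
      have h1 : ¬ (b ≤ M / x ∧ b ≤ M / y) := fun h =>
        hb' (Finset.mem_Icc.2 ⟨(Finset.mem_Icc.1 hb).1, le_min h.1 h.2⟩)
      rw [not_and_or] at h1
      rcases h1 with h1 | h1 <;> simp [v, h1]
  have hrow : ∀ y ∈ A, ∑ x ∈ A, ‖∑ b ∈ B, v x b * (starRingEnd ℂ) (v y b)‖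
      ≤ (2 * N / q + 1) * (2 * (M / N) + 4 * q * (1 + Real.log q)) := by
    intro y hy
    rw [Finset.sum_congr rfl fun x hx => by rw [hcorr x hx y hy]]
    refine (Finset.sum_le_sum_of_subset_of_nonneg (t := Finset.Ico N (N + N))
      (fun x hx => Finset.mem_Ico.2 (hA x hx)) fun _ _ _ => norm_nonneg _).trans ?_
    refine sum_Ico_le α a q hq hg hα (-(α * y)) N N _ (M / N) (by positivity) ?_ ?_
    · intro x hx
      refine (norm_sum_expTwoPi_le _ _).trans (le_trans ?_ Nat.cast_div_le)
      exact_mod_cast (min_le_left _ _).trans (Nat.div_le_div_left (Finset.mem_Ico.1 hx).1 hN)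
    · exact fun x _ => norm_sum_expTwoPi_mul_distInt_le _ _
  have hcard : (A.card : ℝ) ≤ N := by
    have h := Finset.card_le_card (fun x hx => Finset.mem_Ico.2 (hA x hx) : A ⊆ Finset.Ico N (N + N))
    rw [Nat.card_Ico, Nat.add_sub_cancel] at h
    exact_mod_cast h
  have hBcard : (B.card : ℝ) ≤ M / N := by
    rw [hB, Nat.card_Icc, Nat.add_sub_cancel]
    exact Nat.cast_div_le
  have hRM := sum_norm_sq_triangular_le B v φ ψ K 0 A fun x hx => ⟨Nat.zero_le _, by
    simpa using hφ x hx⟩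
  set E : ℝ := (2 * N / q + 1) * (2 * (M / N) + 4 * q * (1 + Real.log q)) with hE
  have hE0 : 0 ≤ E := by positivity
  rw [Finset.sum_comm] at hRM
  have hG : ∑ y ∈ A, ∑ x ∈ A, ‖∑ b ∈ B, v x b * (starRingEnd ℂ) (v y b)‖ ≤ N * E := by
    refine (Finset.sum_le_sum hrow).trans ?_
    rw [Finset.sum_const, nsmul_eq_mul]
    gcongr
  rw [hrew]
  calc ‖∑ b ∈ B, ∑ x ∈ A with ψ b ≤ φ x, v x b‖ ^ 2
      ≤ (∑ b ∈ B, ‖∑ x ∈ A with ψ b ≤ φ x, v x b‖) ^ 2 := by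
        gcongr; exact norm_sum_le _ _
    _ ≤ B.card * ∑ b ∈ B, ‖∑ x ∈ A with ψ b ≤ φ x, v x b‖ ^ 2 := sq_sum_le_card_mul_sum_sq
    _ ≤ (M / N) * (((K : ℝ) + 1) ^ 2 * (N * E)) := by
        rw [Finset.sum_comm] at hG
        rw [Finset.sum_comm] at hRM
        gcongr
        exact hRM.trans (by gcongr)
    _ = M * ((K : ℝ) + 1) ^ 2 * E := by field_simp

/-! ### Exponential sums over smooth integers. -/

theorem le_maxFac {n p : ℕ} (hn : n ≠ 0) (hp : p.Prime) (hd : p ∣ n) : p ≤ maxFac n :=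
  (maxFac_le_iff hn).1 le_rfl p hp hd

/-- The integers `a > U` with all prime factors at most `U ^ 2` such that removing the least prime
factor of `a` leaves at most `U`. -/
def initialParts (U M : ℕ) : Finset ℕ :=
  {x ∈ Finset.Icc 1 M | maxFac x ≤ U ^ 2 ∧ U < x ∧ x / x.minFac ≤ U}

/-- For composite `x` the least prime is at most the cofactor, which is at most `U`. For prime `x`
only the smoothness condition gives the bound. -/
theorem le_sq_of_mem_initialParts {U M x : ℕ} (hU : 0 < U) (hx : x ∈ initialParts U M) :
    x ≤ U ^ 2 := by
  simp only [initialParts, Finset.mem_filter, Finset.mem_Icc] at hx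
  obtain ⟨-, hmax, hUx, hdiv⟩ := hx
  have hx1 : x ≠ 1 := by omega
  have hp := Nat.minFac_prime hx1
  have hmul := Nat.div_mul_cancel (Nat.minFac_dvd x)
  by_cases hc : x / x.minFac = 1
  · rw [hc, one_mul] at hmul
    have := le_maxFac (by omega : x ≠ 0) hp (Nat.minFac_dvd x)
    omega
  · have hc0 : 0 < x / x.minFac := Nat.div_pos (Nat.minFac_le (by omega)) hp.pos
    have h1 : x.minFac ≤ (x / x.minFac).minFac :=
      Nat.minFac_le_of_dvd (Nat.minFac_prime hc).two_le
        ((Nat.minFac_dvd _).trans (Nat.div_dvd_of_dvd (Nat.minFac_dvd x)))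
    have h2 := Nat.minFac_le hc0
    nlinarith

/-- The bijection is the factorization of `existsUnique_mul_eq`. Smoothness of `b` need not be
imposed: its primes are at most `x.minFac ≤ U ^ 2`. -/
theorem sum_smooth_eq (h : ℕ → ℂ) (U M : ℕ) (hU : 0 < U) :
    ∑ n ∈ Finset.Icc 1 M with maxFac n ≤ U ^ 2 ∧ U < n, h n
      = ∑ x ∈ initialParts U M, ∑ b ∈ Finset.Icc 1 (M / x) with maxFac b ≤ x.minFac,
          h (x * b) := by
  rw [Finset.sum_sigma']
  symm
  refine Finset.sum_nbij (fun y => y.1 * y.2) ?_ ?_ ?_ ?_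
  · rintro ⟨x, b⟩ hy
    simp only [initialParts, Finset.mem_sigma, Finset.mem_filter, Finset.mem_Icc] at hy ⊢
    obtain ⟨⟨⟨hx, -⟩, hmax, hUx, hdiv⟩, ⟨hb, hbM⟩, hmaxb⟩ := hy
    have hle : x ≤ x * b := Nat.le_mul_of_pos_right _ hb
    refine ⟨⟨by omega, ?_⟩, ?_, by omega⟩
    · rw [mul_comm]
      exact (Nat.le_div_iff_mul_le hx).1 hbM
    · rw [maxFac_le_iff (by omega)]
      intro p hp hd
      rcases hp.dvd_mul.1 hd with h1 | h1
      · exact (le_maxFac (by omega) hp h1).trans hmax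
      · refine ((le_maxFac (by omega) hp h1).trans hmaxb).trans (le_trans ?_ hmax)
        exact le_maxFac (by omega) (Nat.minFac_prime (by omega)) (Nat.minFac_dvd x)
  · rintro ⟨x, b⟩ hy ⟨x', b'⟩ hy' heq
    simp only [initialParts, Finset.coe_sigma, Set.mem_sigma_iff, Finset.mem_coe,
      Finset.mem_filter, Finset.mem_Icc] at hy hy' heq
    have hle : x ≤ x * b := Nat.le_mul_of_pos_right _ hy.2.1.1
    have := (existsUnique_mul_eq U (x * b) hU (by omega)).unique (y₁ := (x, b)) (y₂ := (x', b'))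
      ⟨rfl, hy.1.2.2.1, hy.1.2.2.2, hy.2.2⟩ ⟨heq.symm, hy'.1.2.2.1, hy'.1.2.2.2, hy'.2.2⟩
    rw [Prod.mk.injEq] at this
    obtain ⟨rfl, rfl⟩ := this
    rfl
  · intro n hn
    simp only [Finset.coe_filter, Finset.mem_Icc, Set.mem_ofPred_eq] at hn
    obtain ⟨⟨hn1, hnM⟩, hmax, hUn⟩ := hn
    obtain ⟨⟨x, b⟩, ⟨hxb, hUx, hdiv, hmaxb⟩, -⟩ := existsUnique_mul_eq U n hU hUn
    simp only at hxb hUx hdiv hmaxb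
    have hb0 : b ≠ 0 := by rintro rfl; simp at hxb; omega
    have hle : x ≤ x * b := Nat.le_mul_of_pos_right _ (by omega)
    refine ⟨⟨x, b⟩, ?_, hxb⟩
    simp only [initialParts, Finset.coe_sigma, Set.mem_sigma_iff, Finset.mem_coe,
      Finset.mem_filter, Finset.mem_Icc]
    refine ⟨⟨⟨by omega, by omega⟩, ?_, hUx, hdiv⟩, ⟨by omega, ?_⟩, hmaxb⟩
    · rw [maxFac_le_iff (by omega)]
      intro p hp hd
      exact (le_maxFac (by omega) hp (hxb ▸ hd.mul_right b)).trans hmax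
    · exact (Nat.le_div_iff_mul_le (by omega)).2 (by rw [mul_comm, hxb]; exact hnM)
  · rintro ⟨x, b⟩ _
    rfl

/-- Integers `n ≤ U` are counted trivially. For the rest, `x` is split dyadically and each range is
a bilinear sum with `φ = minFac` and `ψ = maxFac`. -/
theorem norm_sum_smooth_le (α : ℝ) (a : ℤ) (q : ℕ) (hq : 0 < q) (hg : Int.gcd a q = 1)
    (hα : |α - a / q| ≤ 1 / (q : ℝ) ^ 2) (M U : ℕ) (hU : 0 < U) :
    ‖∑ n ∈ Finset.Icc 1 M with maxFac n ≤ U ^ 2, expTwoPi (α * n)‖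
      ≤ U + (Nat.log 2 M + 1) * √(M * ((Nat.log 2 M : ℝ) + 2) ^ 2 *
        (4 * (M / q) + 4 * (M / U) + (8 * U ^ 2 + 4 * q) * (1 + Real.log q))) := by
  classical
  have hq' : (0 : ℝ) < q := by exact_mod_cast hq
  have hU' : (0 : ℝ) < U := by exact_mod_cast hU
  have hlog : 0 ≤ Real.log q := Real.log_natCast_nonneg q
  set R : ℝ := √(M * ((Nat.log 2 M : ℝ) + 2) ^ 2 *
        (4 * (M / q) + 4 * (M / U) + (8 * U ^ 2 + 4 * q) * (1 + Real.log q))) with hR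
  rw [← Finset.sum_filter_add_sum_filter_not _ (fun n => U < n), Finset.filter_filter,
    add_comm]
  refine (norm_add_le _ _).trans (add_le_add ?_ ?_)
  · refine (norm_sum_le _ _).trans ?_
    simp only [norm_expTwoPi, Finset.sum_const, nsmul_eq_mul, mul_one]
    have : (((Finset.Icc 1 M).filter (fun n => maxFac n ≤ U ^ 2)).filter (fun n => ¬ U < n)).card
        ≤ (Finset.Icc 1 U).card := by
      refine Finset.card_le_card fun n hn => ?_
      simp only [Finset.mem_filter, Finset.mem_Icc] at hn ⊢
      omega
    rw [Nat.card_Icc, Nat.add_sub_cancel] at this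
    exact_mod_cast this
  · rw [sum_smooth_eq (fun n => expTwoPi (α * n)) U M hU]
    have hmaps : ∀ x ∈ initialParts U M, Nat.log 2 x ∈ Finset.range (Nat.log 2 M + 1) := by
      intro x hx
      simp only [initialParts, Finset.mem_filter, Finset.mem_Icc] at hx
      rw [Finset.mem_range, Nat.lt_succ_iff]
      exact Nat.log_mono_right hx.1.2
    rw [← Finset.sum_fiberwise_of_maps_to hmaps]
    refine (norm_sum_le _ _).trans ((Finset.sum_le_card_nsmul _ _ R ?_).trans_eq (by simp))
    intro k _
    -- An element `x₀` of the dyadic class is what yields `U ≤ 2N` and `N ≤ U²`.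
    by_cases hne : ((initialParts U M).filter fun x => Nat.log 2 x = k) = ∅
    · rw [hne]; simp [hR]
    obtain ⟨x₀, hx₀⟩ := Finset.nonempty_iff_ne_empty.2 hne
    have hmem : ∀ x ∈ (initialParts U M).filter fun x => Nat.log 2 x = k,
        2 ^ k ≤ x ∧ x < 2 ^ k + 2 ^ k ∧ x ≤ M ∧ x ≤ U ^ 2 ∧ U < x := by
      intro x hx
      rw [Finset.mem_filter] at hx
      have h1 := le_sq_of_mem_initialParts hU hx.1
      have h2 := hx.2
      have h3 := hx.1
      simp only [initialParts, Finset.mem_filter, Finset.mem_Icc] at h3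
      have h4 := Nat.pow_log_le_self 2 (x := x) (by omega)
      have h5 := Nat.lt_pow_succ_log_self (b := 2) (by norm_num) x
      rw [h2] at h4 h5
      rw [pow_succ] at h5
      exact ⟨h4, by omega, by omega, h1, by omega⟩
    have hb := norm_sum_bilinear_sq_le α a q hq hg hα M (2 ^ k) (by positivity) _
      (fun x hx => ⟨(hmem x hx).1, (hmem x hx).2.1⟩) Nat.minFac maxFac (Nat.log 2 M + 1)
      (fun x hx => by
        have h := hmem x hx
        have h1 : x.minFac ≤ x := Nat.minFac_le (by omega)
        have h2 := Nat.lt_pow_succ_log_self (b := 2) (by norm_num) M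
        rw [Nat.succ_eq_add_one] at h2
        omega)
    refine Real.le_sqrt_of_sq_le (hb.trans ?_)
    obtain ⟨h1, h2, -, h4, h5⟩ := hmem x₀ hx₀
    set N := 2 ^ k with hN
    have hN0 : (0 : ℝ) < N := by rw [hN]; positivity
    have hNU : (N : ℝ) ≤ U ^ 2 := by exact_mod_cast h1.trans h4
    have hUN : (U : ℝ) ≤ 2 * N := by exact_mod_cast (by omega : U ≤ 2 * N)
    push_cast
    rw [show (Nat.log 2 M : ℝ) + 1 + 1 = Nat.log 2 M + 2 by ring]
    refine mul_le_mul_of_nonneg_left ?_ (by positivity)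
    have e1 : (M : ℝ) / N ≤ 2 * (M / U) := by
      rw [mul_div_assoc', div_le_div_iff₀ hN0 hU']
      nlinarith [(Nat.cast_nonneg M : (0 : ℝ) ≤ M)]
    have e2 : (2 * N / q + 1) * (2 * (M / N) + 4 * q * (1 + Real.log q))
        = 4 * (M / q) + 2 * (M / N) + (8 * N + 4 * q) * (1 + Real.log q) := by
      field_simp; ring
    rw [e2]
    have e3 : (8 * N + 4 * q) * (1 + Real.log q) ≤ (8 * (U : ℝ) ^ 2 + 4 * q) * (1 + Real.log q) := by
      gcongr
    linarith

/-! ### Splitting additive functions; the contribution of higher prime powers. -/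

theorem IsClassFZero.apply_one {f : ℕ → ℂ} (hf : IsClassFZero f) : f 1 = 0 := by
  simpa using hf.additive 1 1 one_pos one_pos (Nat.coprime_one_left 1)

theorem IsClassFZero.eq_sum_primeFactors {f : ℕ → ℂ} (hf : IsClassFZero f) (n : ℕ) (hn : 0 < n) :
    f n = ∑ p ∈ n.primeFactors, f (p ^ n.factorization p) := by
  induction n using Nat.recOnPosPrimePosCoprime with
  | zero => omega
  | one => simp [hf.apply_one]
  | prime_pow p k hp hk =>
    rw [Nat.primeFactors_prime_pow hk.ne' hp]
    simp [hp.factorization]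
  | coprime a b ha hb hab iha ihb =>
    rw [hf.additive a b (by omega) (by omega) hab, iha (by omega), ihb (by omega),
      hab.primeFactors_mul, Finset.sum_union hab.disjoint_primeFactors]
    congr 1 <;> refine Finset.sum_congr rfl fun p hp => ?_
    · rw [Nat.factorization_eq_of_coprime_left hab (by simpa using hp)]
    · rw [Nat.factorization_eq_of_coprime_right hab (by simpa using hp)]

theorem card_primeFactors_le_log (n : ℕ) (hn : 0 < n) : n.primeFactors.card ≤ Nat.log 2 n := by
  refine Nat.le_log_of_pow_le (by norm_num) ?_
  calc 2 ^ n.primeFactors.card ≤ ∏ p ∈ n.primeFactors, p :=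
        Finset.pow_card_le_prod _ _ _ fun p hp => (Nat.prime_of_mem_primeFactors hp).two_le
    _ ≤ n := Nat.le_of_dvd hn (Nat.prod_primeFactors_dvd n)

theorem IsClassFZero.norm_apply_le {f : ℕ → ℂ} (hf : IsClassFZero f) (M : ℕ) (F : ℝ)
    (hF : ∀ p l : ℕ, p.Prime → 1 ≤ l → p ^ l ≤ M → ‖f (p ^ l)‖ ≤ F) (hF1 : 1 ≤ F)
    (n : ℕ) (hn : 0 < n) (hnM : n ≤ M) : ‖f n‖ ≤ Nat.log 2 M * F := by
  rw [hf.eq_sum_primeFactors n hn]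
  refine (norm_sum_le _ _).trans ((Finset.sum_le_card_nsmul _ _ F fun p hp => ?_).trans ?_)
  · have hpp := Nat.prime_of_mem_primeFactors hp
    exact hF p _ hpp (hpp.factorization_pos_of_dvd hn.ne' (Nat.dvd_of_mem_primeFactors hp))
      ((Nat.ordProj_le p hn.ne').trans hnM)
  · rw [nsmul_eq_mul]
    gcongr
    exact (card_primeFactors_le_log n hn).trans (Nat.log_mono_right hnM)

theorem primeFactors_eq_filter (M n : ℕ) (hn : 0 < n) (hnM : n ≤ M) :
    n.primeFactors = {p ∈ Finset.Icc 1 M | p.Prime ∧ p ∣ n} := by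
  ext p
  simp only [Nat.mem_primeFactors, Finset.mem_filter, Finset.mem_Icc]
  constructor
  · rintro ⟨hp, hd, -⟩
    exact ⟨⟨hp.one_le, (Nat.le_of_dvd hn hd).trans hnM⟩, hp, hd⟩
  · rintro ⟨-, hp, hd⟩
    exact ⟨hp, hd, hn.ne'⟩

/-- The sum of `e(αn)` over the `n ≤ M` exactly divisible by `p ^ k`. -/
noncomputable def exactSum (α : ℝ) (M p k : ℕ) : ℂ :=
  ∑ n ∈ Finset.Icc 1 M with n.factorization p = k, expTwoPi (α * n)

theorem exactSum_eq_sub (α : ℝ) (M p k : ℕ) (hp : p.Prime) :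
    exactSum α M p k = multipleSum α M (p ^ k) - multipleSum α M (p ^ (k + 1)) := by
  rw [exactSum, multipleSum, multipleSum, Finset.sum_filter, Finset.sum_filter, Finset.sum_filter,
    ← Finset.sum_sub_distrib]
  refine Finset.sum_congr rfl fun n hn => ?_
  have hn0 : n ≠ 0 := by rw [Finset.mem_Icc] at hn; omega
  simp only [hp.pow_dvd_iff_le_factorization hn0]
  split_ifs <;> first | omega | simp

theorem exactSum_eq_zero (α : ℝ) (M p k : ℕ) (hk : M < p ^ k) :
    exactSum α M p k = 0 := by
  rw [exactSum, Finset.filter_false_of_mem, Finset.sum_empty]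
  intro n hn h
  rw [Finset.mem_Icc] at hn
  have := Nat.ordProj_le p (n := n) (by omega)
  rw [h] at this
  omega

/-- Splitting an additive function that is `1` on primes into `ω` and a function supported on
integers which are not squarefree. -/
theorem IsClassFZero.sum_eq {f : ℕ → ℂ} (hf : IsClassFZero f) (α : ℝ) (M : ℕ) :
    ∑ n ∈ Finset.Icc 1 M, f n * expTwoPi (α * n)
      = ∑ p ∈ Finset.Icc 1 M with p.Prime, multipleSum α M p
        + ∑ p ∈ Finset.Icc 1 M with p.Prime, ∑ k ∈ Finset.Icc 2 (Nat.log 2 M),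
            (f (p ^ k) - 1) * exactSum α M p k := by
  have h1 : ∀ n ∈ Finset.Icc 1 M, f n * expTwoPi (α * n)
      = ∑ p ∈ Finset.Icc 1 M with p.Prime, ((if p ∣ n then expTwoPi (α * n) else 0)
        + ∑ k ∈ Finset.Icc 2 (Nat.log 2 M),
          (if n.factorization p = k then (f (p ^ k) - 1) * expTwoPi (α * n) else 0)) := by
    intro n hn
    rw [Finset.mem_Icc] at hn
    rw [hf.eq_sum_primeFactors n hn.1, primeFactors_eq_filter M n hn.1 hn.2,
      ← Finset.filter_filter, Finset.sum_filter, Finset.sum_mul]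
    refine Finset.sum_congr rfl fun p hp => ?_
    have hpp := (Finset.mem_filter.1 hp).2
    rw [Finset.sum_ite_eq]
    by_cases hd : p ∣ n
    · have hpos := hpp.factorization_pos_of_dvd (by omega) hd
      rw [if_pos hd, if_pos hd]
      by_cases h2 : 2 ≤ n.factorization p
      · rw [if_pos]
        · ring
        · rw [Finset.mem_Icc]
          refine ⟨h2, Nat.le_log_of_pow_le (by norm_num) ?_⟩
          exact (Nat.pow_le_pow_left hpp.two_le _).trans
            ((Nat.ordProj_le p (by omega)).trans hn.2)
      · rw [if_neg (by rw [Finset.mem_Icc]; omega), show n.factorization p = 1 by omega, pow_one,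
          hf.prime_eq_one p hpp, one_mul, add_zero]
    · rw [if_neg hd, if_neg hd, if_neg]
      · simp
      · rw [Nat.factorization_eq_zero_of_not_dvd hd, Finset.mem_Icc]; omega
  rw [Finset.sum_congr rfl h1, Finset.sum_comm, ← Finset.sum_add_distrib]
  refine Finset.sum_congr rfl fun p _ => ?_
  rw [Finset.sum_add_distrib, multipleSum, Finset.sum_filter, Finset.sum_comm]
  congr 1
  refine Finset.sum_congr rfl fun k _ => ?_
  rw [exactSum, ← Finset.sum_filter, Finset.mul_sum]

/-- Prime powers up to `U²` are distinct integers, hence bounded by the linear sum. If `p ^ k > U²`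
with `k ≥ 2`, then `(p ^ k)² ≥ (U p)²`, and `M / (U p)` is summed harmonically over `p`. -/
theorem sum_norm_multipleSum_primePow_le (α : ℝ) (M U : ℕ) (hU : 0 < U) (K : ℕ) :
    ∑ p ∈ Finset.Icc 1 M with p.Prime, ∑ k ∈ Finset.Icc 2 (K + 1), ‖multipleSum α M (p ^ k)‖
      ≤ ∑ r ∈ Finset.Icc 1 (U ^ 2), ‖multipleSum α M r‖ + K * (M / U) * (1 + Real.log M) := by
  classical
  have hU' : (0 : ℝ) < U := by exact_mod_cast hU
  rw [← Finset.sum_product', ← Finset.sum_filter_add_sum_filter_not _ (fun x => x.1 ^ x.2 ≤ U ^ 2)]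
  refine add_le_add ?_ ?_
  · rw [← Finset.sum_image (f := fun r => ‖multipleSum α M r‖) (g := fun x : ℕ × ℕ => x.1 ^ x.2)]
    · refine Finset.sum_le_sum_of_subset_of_nonneg ?_ fun _ _ _ => norm_nonneg _
      intro r hr
      obtain ⟨⟨p, k⟩, hx, rfl⟩ := Finset.mem_image.1 hr
      simp only [Finset.mem_filter, Finset.mem_product, Finset.mem_Icc] at hx ⊢
      exact ⟨Nat.pow_pos hx.1.1.1.1, hx.2⟩
    · rintro ⟨p, k⟩ hx ⟨p', k'⟩ hx' heq
      simp only [Finset.coe_filter, Finset.mem_product, Finset.mem_filter, Finset.mem_Icc,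
        Set.mem_ofPred_eq] at hx hx' heq
      obtain ⟨h1, h2⟩ := hx.1.1.2.pow_inj' hx'.1.1.2 (by omega) (by omega) heq
      rw [h1, h2]
  · have hterm : ∀ x ∈ (((Finset.Icc 1 M).filter Nat.Prime) ×ˢ Finset.Icc 2 (K + 1)).filter
        (fun x => ¬ x.1 ^ x.2 ≤ U ^ 2), ‖multipleSum α M (x.1 ^ x.2)‖ ≤ M / U * (1 / x.1) := by
      rintro ⟨p, k⟩ hx
      simp only [Finset.mem_filter, Finset.mem_product, Finset.mem_Icc, not_le] at hx
      obtain ⟨⟨⟨⟨hp1, -⟩, -⟩, hk, -⟩, hUp⟩ := hx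
      refine (norm_multipleSum_le α M _ (Nat.pow_pos hp1)).trans ?_
      simp only
      have hp0 : (0 : ℝ) < p := by exact_mod_cast hp1
      rw [div_mul_div_comm, mul_one]
      refine div_le_div_of_nonneg_left (Nat.cast_nonneg _) (by positivity) ?_
      have h1 : p ^ 2 ≤ p ^ k := Nat.pow_le_pow_right hp1 hk
      have h2 : U * p ≤ p ^ k := by
        have h3 : (U * p) ^ 2 ≤ (p ^ k) ^ 2 := by
          rw [mul_pow, sq (p ^ k)]
          exact Nat.mul_le_mul hUp.le h1
        exact (Nat.pow_le_pow_iff_left (by norm_num)).1 h3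
      exact_mod_cast h2
    refine (Finset.sum_le_sum hterm).trans ?_
    refine (Finset.sum_le_sum_of_subset_of_nonneg (Finset.filter_subset _ _)
      fun _ _ _ => by positivity).trans ?_
    rw [Finset.sum_product]
    simp only [Finset.sum_const, Nat.card_Icc, nsmul_eq_mul]
    rw [← Finset.mul_sum, ← Finset.mul_sum, show K + 1 + 1 - 2 = K by omega, mul_assoc]
    refine mul_le_mul_of_nonneg_left (mul_le_mul_of_nonneg_left ?_ (by positivity))
      (Nat.cast_nonneg _)
    exact (Finset.sum_le_sum_of_subset_of_nonneg (Finset.filter_subset _ _)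
      fun _ _ _ => by positivity).trans (sum_one_div_le_one_add_log M)

/-- Each exact sum is a difference of multiple sums at exponents `k` and `k + 1`, and `‖f (p ^ k) -
1‖ ≤ 2F`: two factors of 2. Powers beyond `M`, where `F` says nothing, contribute zero. -/
theorem norm_sum_exactSum_le {f : ℕ → ℂ} (α : ℝ) (M U : ℕ) (hU : 0 < U) (F : ℝ)
    (hF : ∀ p l : ℕ, p.Prime → 1 ≤ l → p ^ l ≤ M → ‖f (p ^ l)‖ ≤ F) (hF1 : 1 ≤ F) :
    ‖∑ p ∈ Finset.Icc 1 M with p.Prime, ∑ k ∈ Finset.Icc 2 (Nat.log 2 M),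
            (f (p ^ k) - 1) * exactSum α M p k‖
      ≤ 4 * F * (∑ r ∈ Finset.Icc 1 (U ^ 2), ‖multipleSum α M r‖
          + Nat.log 2 M * (M / U) * (1 + Real.log M)) := by
  refine le_trans ?_ (mul_le_mul_of_nonneg_left
    (sum_norm_multipleSum_primePow_le α M U hU (Nat.log 2 M)) (by linarith))
  rw [Finset.mul_sum]
  refine (norm_sum_le _ _).trans (Finset.sum_le_sum fun p hp => ?_)
  have hpp := (Finset.mem_filter.1 hp).2
  set K := Nat.log 2 M
  have h1 : ∀ k ∈ Finset.Icc 2 K, ‖(f (p ^ k) - 1) * exactSum α M p k‖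
      ≤ 2 * F * (‖multipleSum α M (p ^ k)‖ + ‖multipleSum α M (p ^ (k + 1))‖) := by
    intro k hk
    rw [Finset.mem_Icc] at hk
    by_cases hM : p ^ k ≤ M
    · rw [norm_mul]
      refine mul_le_mul ?_ ?_ (norm_nonneg _) (by linarith)
      · refine (norm_sub_le _ _).trans ?_
        rw [norm_one]
        linarith [hF p k hpp (by omega) hM]
      · rw [exactSum_eq_sub α M p k hpp]
        exact norm_sub_le _ _
    · rw [exactSum_eq_zero α M p k (not_le.1 hM), mul_zero, norm_zero]
      positivity
  refine (norm_sum_le _ _).trans ((Finset.sum_le_sum h1).trans ?_)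
  rw [← Finset.mul_sum, Finset.sum_add_distrib]
  have h2 : ∑ k ∈ Finset.Icc 2 K, ‖multipleSum α M (p ^ k)‖
      ≤ ∑ k ∈ Finset.Icc 2 (K + 1), ‖multipleSum α M (p ^ k)‖ :=
    Finset.sum_le_sum_of_subset_of_nonneg (Finset.Icc_subset_Icc_right (by omega))
      fun _ _ _ => norm_nonneg _
  have h3 : ∑ k ∈ Finset.Icc 2 K, ‖multipleSum α M (p ^ (k + 1))‖
      ≤ ∑ k ∈ Finset.Icc 2 (K + 1), ‖multipleSum α M (p ^ k)‖ := by
    rw [← Finset.sum_image (f := fun k => ‖multipleSum α M (p ^ k)‖) (g := fun k => k + 1)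
      (fun x _ y _ h => by simpa using h)]
    refine Finset.sum_le_sum_of_subset_of_nonneg ?_ fun _ _ _ => norm_nonneg _
    intro k hk
    obtain ⟨j, hj, rfl⟩ := Finset.mem_image.1 hk
    rw [Finset.mem_Icc] at hj ⊢
    omega
  nlinarith

/-! ### The sum over primes. -/

/-- Two distinct primes above `U²` have product above `U⁴ ≥ M`, so each non-smooth `n ≤ M` is
counted exactly once. -/
theorem sum_multipleSum_large_prime_eq (α : ℝ) (M U : ℕ) (hUM : M ≤ U ^ 4) :
    ∑ p ∈ Finset.Icc 1 M with p.Prime ∧ U ^ 2 < p, multipleSum α M p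
      = multipleSum α M 1 - ∑ n ∈ Finset.Icc 1 M with maxFac n ≤ U ^ 2, expTwoPi (α * n) := by
  simp only [multipleSum, one_dvd, Finset.filter_true]
  rw [← Finset.sum_filter_add_sum_filter_not (Finset.Icc 1 M) (fun n => maxFac n ≤ U ^ 2),
    add_sub_cancel_left]
  simp only [Finset.sum_filter (p := fun n => _ ∣ n)]
  rw [Finset.sum_comm, Finset.sum_filter]
  refine Finset.sum_congr rfl fun n hn => ?_
  rw [Finset.mem_Icc] at hn
  rw [← Finset.sum_filter, Finset.sum_const, nsmul_eq_mul]
  by_cases hmax : maxFac n ≤ U ^ 2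
  · rw [if_neg (not_not.2 hmax), Finset.filter_false_of_mem]
    · simp
    · intro p hp hd
      have h := (Finset.mem_filter.1 hp).2
      have := le_maxFac (by omega) h.1 hd
      omega
  · rw [if_pos hmax, Finset.card_eq_one.2, Nat.cast_one, one_mul]
    have h1 := (maxFac_le_iff (by omega : n ≠ 0)).not.1 hmax
    push Not at h1
    obtain ⟨p, hp, hd, hUp⟩ := h1
    refine ⟨p, Finset.eq_singleton_iff_unique_mem.2 ⟨?_, ?_⟩⟩
    · simp only [Finset.mem_filter, Finset.mem_Icc]
      exact ⟨⟨⟨hp.one_le, (Nat.le_of_dvd hn.1 hd).trans hn.2⟩, hp, hUp⟩, hd⟩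
    · intro p' hp'
      simp only [Finset.mem_filter, Finset.mem_Icc] at hp'
      by_contra hne
      have hdvd := ((Nat.coprime_primes hp'.1.2.1 hp).2 hne).mul_dvd_of_dvd_of_dvd hp'.2 hd
      have hle := Nat.le_of_dvd hn.1 hdvd
      have h2 := hp'.1.2.2
      have : U ^ 2 * U ^ 2 < p' * p := Nat.mul_lt_mul'' h2 hUp
      have h3 : U ^ 2 * U ^ 2 = U ^ 4 := by ring
      omega

theorem norm_sum_multipleSum_prime_le (α : ℝ) (M U : ℕ) (hU : 0 < U) (hUM : M ≤ U ^ 4) :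
    ‖∑ p ∈ Finset.Icc 1 M with p.Prime, multipleSum α M p‖
      ≤ 2 * ∑ r ∈ Finset.Icc 1 (U ^ 2), ‖multipleSum α M r‖
        + ‖∑ n ∈ Finset.Icc 1 M with maxFac n ≤ U ^ 2, expTwoPi (α * n)‖ := by
  rw [← Finset.sum_filter_add_sum_filter_not _ (fun p => U ^ 2 < p), Finset.filter_filter,
    Finset.filter_filter, sum_multipleSum_large_prime_eq α M U hUM]
  have h1 : ‖multipleSum α M 1‖ ≤ ∑ r ∈ Finset.Icc 1 (U ^ 2), ‖multipleSum α M r‖ :=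
    Finset.single_le_sum (f := fun r => ‖multipleSum α M r‖) (fun _ _ => norm_nonneg _)
      (Finset.mem_Icc.2 ⟨le_rfl, Nat.one_le_pow _ _ hU⟩)
  have h2 : ‖∑ p ∈ Finset.Icc 1 M with p.Prime ∧ ¬ U ^ 2 < p, multipleSum α M p‖
      ≤ ∑ r ∈ Finset.Icc 1 (U ^ 2), ‖multipleSum α M r‖ := by
    refine (norm_sum_le _ _).trans
      (Finset.sum_le_sum_of_subset_of_nonneg ?_ fun _ _ _ => norm_nonneg _)
    intro p hp
    simp only [Finset.mem_filter, Finset.mem_Icc, not_lt] at hp ⊢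
    exact ⟨hp.1.1, hp.2.2⟩
  refine (norm_add_le _ _).trans ?_
  linarith [norm_sub_le (multipleSum α M 1)
    (∑ n ∈ Finset.Icc 1 M with maxFac n ≤ U ^ 2, expTwoPi (α * n))]

/-! ### Choice of `U` and the final estimates. -/

theorem natLog_two_le_two_mul_log (M : ℕ) (hM : 0 < M) : (Nat.log 2 M : ℝ) ≤ 2 * Real.log M := by
  have h1 : ((2 ^ Nat.log 2 M : ℕ) : ℝ) ≤ M := by
    exact_mod_cast Nat.pow_log_le_self 2 hM.ne'
  have h2 := Real.log_le_log (by positivity) h1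
  rw [Nat.cast_pow, Real.log_pow, Nat.cast_two] at h2
  have := Real.log_two_gt_d9
  nlinarith [(Nat.cast_nonneg (Nat.log 2 M) : (0 : ℝ) ≤ _)]

/-- `U = ⌊M^(1/3)⌋`. The threshold 27 gives `U ≥ 3`, from which point `(U + 1)³ ≤ U⁴`. -/
theorem exists_nat_cube_root (M : ℕ) (hM : 27 ≤ M) :
    ∃ U : ℕ, 0 < U ∧ M ≤ U ^ 4 ∧ U ^ 3 ≤ M ∧ (M : ℝ) ^ (1 / 3 : ℝ) ≤ 2 * U := by
  have hM0 : (0 : ℝ) ≤ M := Nat.cast_nonneg _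
  have hcube : ((M : ℝ) ^ (1 / 3 : ℝ)) ^ 3 = M := by
    rw [← Real.rpow_natCast, ← Real.rpow_mul hM0]; norm_num
  have hr0 : 0 ≤ (M : ℝ) ^ (1 / 3 : ℝ) := by positivity
  set r := (M : ℝ) ^ (1 / 3 : ℝ)
  have hM' : (27 : ℝ) ≤ M := by exact_mod_cast hM
  have hr3 : (3 : ℝ) ≤ r := by
    refine le_of_pow_le_pow_left₀ (n := 3) (by norm_num) hr0 ?_
    rw [hcube]; norm_num; linarith
  have hU3 : 3 ≤ ⌊r⌋₊ := Nat.le_floor (by exact_mod_cast hr3)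
  have h1 := Nat.floor_le hr0
  have h2 := Nat.lt_floor_add_one r
  have hU3' : (3 : ℝ) ≤ ⌊r⌋₊ := by exact_mod_cast hU3
  refine ⟨⌊r⌋₊, by omega, ?_, ?_, by linarith⟩
  · have h3 : (M : ℝ) ≤ (⌊r⌋₊ + 1) ^ 3 := by
      rw [← hcube]; gcongr
    have h4 : M ≤ (⌊r⌋₊ + 1) ^ 3 := by exact_mod_cast h3
    refine h4.trans ?_
    obtain ⟨t, ht⟩ : ∃ t, ⌊r⌋₊ = t + 3 := ⟨⌊r⌋₊ - 3, by omega⟩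
    rw [ht]
    ring_nf
    nlinarith [Nat.zero_le (t ^ 3), Nat.zero_le (t ^ 4)]
  · have h3 : (⌊r⌋₊ : ℝ) ^ 3 ≤ M := by
      rw [← hcube]; gcongr
    exact_mod_cast h3

/-- Applied with `m = M`, `x = M/q`, `y = M/U`, `v = U²`, `z = q`, `k = Nat.log 2 M`, `t = log q`,
`ℓ = log M`. The constant is `18 = 3 * 6`, from `k + 2 ≤ 3ℓ` and a bracket of at most `36 ℓ² E²`. -/
theorem sqrt_mul_sq_mul_le {m x y z v E ℓ t k : ℝ}
    (hk : 0 ≤ k) (hkℓ : k ≤ 2 * ℓ) (ht : 0 ≤ t) (htℓ : t ≤ ℓ) (hℓ : 2 ≤ ℓ) (hE : 0 ≤ E)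
    (hx : m * x ≤ E ^ 2) (hy : m * y ≤ 2 * E ^ 2) (hmv : m * v ≤ E ^ 2) (hmz : m * z ≤ E ^ 2) :
    √(m * (k + 2) ^ 2 * (4 * x + 4 * y + (8 * v + 4 * z) * (1 + t))) ≤ 18 * ℓ ^ 2 * E := by
  refine (Real.sqrt_le_left (by positivity)).2 ?_
  have h1 : (m * (8 * v + 4 * z)) * (1 + t) ≤ (12 * E ^ 2) * (1 + ℓ) :=
    mul_le_mul (by linarith) (by linarith) (by linarith) (by positivity)
  have h2 : (12 + 12 * (1 + ℓ)) * E ^ 2 ≤ (36 * ℓ ^ 2) * E ^ 2 :=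
    mul_le_mul_of_nonneg_right (by nlinarith) (by positivity)
  have h3 : m * (4 * x + 4 * y + (8 * v + 4 * z) * (1 + t)) ≤ 36 * ℓ ^ 2 * E ^ 2 := by
    linarith
  have h4 : (k + 2) ^ 2 ≤ (3 * ℓ) ^ 2 := pow_le_pow_left₀ (by linarith) (by linarith) 2
  calc _ = (k + 2) ^ 2 * (m * (4 * x + 4 * y + (8 * v + 4 * z) * (1 + t))) := by ring
    _ ≤ (k + 2) ^ 2 * (36 * ℓ ^ 2 * E ^ 2) := mul_le_mul_of_nonneg_left h3 (by positivity)
    _ ≤ (3 * ℓ) ^ 2 * (36 * ℓ ^ 2 * E ^ 2) := mul_le_mul_of_nonneg_right h4 (by positivity)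
    _ = (18 * ℓ ^ 2 * E) ^ 2 := by ring

theorem IsClassFZero.norm_sum_le {f : ℕ → ℂ} (hf : IsClassFZero f) (α : ℝ) (a : ℤ) (q : ℕ)
    (hq : 0 < q) (hg : Int.gcd a q = 1) (hα : |α - a / q| ≤ 1 / (q : ℝ) ^ 2) (M : ℕ)
    (hM : 27 ≤ M) (hqM : q ≤ M) (F : ℝ)
    (hF : ∀ p l : ℕ, p.Prime → 1 ≤ l → p ^ l ≤ M → ‖f (p ^ l)‖ ≤ F) (hF1 : 1 ≤ F) :
    ‖∑ n ∈ Finset.Icc 1 M, f n * expTwoPi (α * n)‖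
      ≤ 220 * (M / √q + (M : ℝ) ^ (5 / 6 : ℝ) + √(M * q)) *
        (Real.log M ^ 4 + Real.log M * F) := by
  obtain ⟨U, hU, hU4, hU3, hUr⟩ := exists_nat_cube_root M hM
  have hq' : (0 : ℝ) < q := by exact_mod_cast hq
  have hq1 : (1 : ℝ) ≤ q := by exact_mod_cast hq
  have hM' : (0 : ℝ) < M := by exact_mod_cast (by omega : 0 < M)
  have hM1 : (1 : ℝ) ≤ M := by exact_mod_cast (by omega : 1 ≤ M)
  have hqM' : (q : ℝ) ≤ M := by exact_mod_cast hqM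
  have hU' : (0 : ℝ) < U := by exact_mod_cast hU
  set ℓ := Real.log M with hℓ
  set A := (M : ℝ) / √q with hA
  set P := (M : ℝ) ^ (5 / 6 : ℝ) with hP
  set D := √((M : ℝ) * q) with hD
  have hA0 : 0 ≤ A := by positivity
  have hP0 : 0 ≤ P := by positivity
  have hD0 : 0 ≤ D := by positivity
  set E := A + P + D with hE
  have hE0 : 0 ≤ E := by positivity
  have hAE : A ≤ E := by linarith
  have hPE : P ≤ E := by linarith
  have hDE : D ≤ E := by linarith
  have hℓ2 : 2 ≤ ℓ := by
    rw [hℓ, Real.le_log_iff_exp_le hM']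
    have h1 : Real.exp 2 = Real.exp 1 ^ 2 := by rw [← Real.exp_nat_mul]; norm_num
    have h2 := Real.exp_one_lt_d9
    have h3 : (27 : ℝ) ≤ M := by exact_mod_cast hM
    have h4 := Real.exp_pos 1
    rw [h1]; nlinarith
  have hlog2 : (Nat.log 2 M : ℝ) ≤ 2 * ℓ := natLog_two_le_two_mul_log M (by omega)
  have hlog20 : (0 : ℝ) ≤ Nat.log 2 M := Nat.cast_nonneg _
  have hlq : Real.log q ≤ ℓ := Real.log_le_log hq' hqM'
  have hlq0 : 0 ≤ Real.log q := Real.log_natCast_nonneg q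
  have hrpow : ∀ x y : ℝ, (M : ℝ) ^ x * (M : ℝ) ^ y = (M : ℝ) ^ (x + y) :=
    fun x y => (Real.rpow_add hM' x y).symm
  have hmono : ∀ x y : ℝ, x ≤ y → (M : ℝ) ^ x ≤ (M : ℝ) ^ y :=
    fun x y h => Real.rpow_le_rpow_of_exponent_le hM1 h
  -- elementary comparisons with the three terms of `E`
  have hPsq : P ^ 2 = (M : ℝ) ^ (5 / 3 : ℝ) := by
    rw [hP, sq, hrpow]; norm_num
  have hUle : (U : ℝ) ≤ (M : ℝ) ^ (1 / 3 : ℝ) := by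
    refine le_of_pow_le_pow_left₀ (n := 3) (by norm_num) (by positivity) ?_
    rw [← Real.rpow_natCast ((M : ℝ) ^ (1 / 3 : ℝ)), ← Real.rpow_mul hM'.le]
    norm_num
    exact_mod_cast hU3
  have hU2 : (U : ℝ) ^ 2 ≤ (M : ℝ) ^ (2 / 3 : ℝ) := by
    calc (U : ℝ) ^ 2 ≤ ((M : ℝ) ^ (1 / 3 : ℝ)) ^ 2 := by gcongr
      _ = (M : ℝ) ^ (2 / 3 : ℝ) := by rw [sq, hrpow]; norm_num
  have hUE : (U : ℝ) ≤ E := hUle.trans ((hmono _ _ (by norm_num)).trans hPE)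
  have hMU : (M : ℝ) / U ≤ 2 * (M : ℝ) ^ (2 / 3 : ℝ) := by
    rw [div_le_iff₀ hU']
    have : (M : ℝ) = (M : ℝ) ^ (2 / 3 : ℝ) * (M : ℝ) ^ (1 / 3 : ℝ) := by
      rw [hrpow]; norm_num
    have h0 : 0 ≤ (M : ℝ) ^ (2 / 3 : ℝ) := by positivity
    nlinarith
  have hMq : (M : ℝ) / q ≤ A := by
    refine div_le_div_of_nonneg_left hM'.le (by positivity) ?_
    exact (Real.sqrt_le_left hq'.le).2 (by nlinarith)
  have hqD : (q : ℝ) ≤ D := Real.le_sqrt_of_sq_le (by nlinarith)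
  have hAsq : A ^ 2 = M * (M / q) := by
    rw [hA, div_pow, Real.sq_sqrt hq'.le]; ring
  have hDsq : D ^ 2 = M * q := Real.sq_sqrt (by positivity)
  -- `M / U` is only of size `M^(2/3)`; the room up to `M^(5/6)` absorbs one logarithm, so `F` ends
  -- up with a single factor `log M`.
  have hlogpow : 1 + ℓ ≤ 7 * (M : ℝ) ^ (1 / 6 : ℝ) := by
    have h1 := Real.log_le_rpow_div hM'.le (by norm_num : (0 : ℝ) < 1 / 6)
    have h2 := hmono 0 (1 / 6) (by norm_num)
    rw [Real.rpow_zero] at h2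
    have h3 : (M : ℝ) ^ (1 / 6 : ℝ) / (1 / 6) = 6 * (M : ℝ) ^ (1 / 6 : ℝ) := by ring
    rw [← hℓ] at h1
    linarith
  have hMUL : (M : ℝ) / U * (1 + ℓ) ≤ 14 * E := by
    calc (M : ℝ) / U * (1 + ℓ) ≤ (2 * (M : ℝ) ^ (2 / 3 : ℝ)) * (7 * (M : ℝ) ^ (1 / 6 : ℝ)) := by
          gcongr
      _ = 14 * ((M : ℝ) ^ (2 / 3 : ℝ) * (M : ℝ) ^ (1 / 6 : ℝ)) := by ring
      _ = 14 * P := by rw [hrpow, hP]; norm_num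
      _ ≤ 14 * E := by linarith
  -- the linear sums
  have hUM : U ^ 2 ≤ M := (Nat.pow_le_pow_right hU (by norm_num)).trans hU3
  have hT := sum_norm_multipleSum_le α a q hq hg hα M (U ^ 2) hqM hUM
  set T := ∑ r ∈ Finset.Icc 1 (U ^ 2), ‖multipleSum α M r‖
  have hT' : T ≤ 24 * E * ℓ := by
    refine hT.trans ?_
    push_cast
    rw [← hℓ]
    have h1 : (M : ℝ) / q + (U : ℝ) ^ 2 + q ≤ 2 * E := by
      have : (U : ℝ) ^ 2 ≤ P := hU2.trans (hmono _ _ (by norm_num))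
      linarith
    calc 8 * ((M : ℝ) / q + (U : ℝ) ^ 2 + q) * (1 + ℓ) ≤ 8 * (2 * E) * (1.5 * ℓ) := by
          gcongr; linarith
      _ = 24 * E * ℓ := by ring
  -- the bilinear sums
  have hroot : √(M * ((Nat.log 2 M : ℝ) + 2) ^ 2 *
        (4 * (M / q) + 4 * (M / U) + (8 * U ^ 2 + 4 * q) * (1 + Real.log q))) ≤ 18 * ℓ ^ 2 * E := by
    have h1 : (M : ℝ) * (M / q) ≤ E ^ 2 := by rw [← hAsq]; gcongr
    have h2 : (M : ℝ) * q ≤ E ^ 2 := by rw [← hDsq]; gcongr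
    -- This fixes the choice of `U`: at `M^(1/3)` both `U²` and `M/U` have order `M^(2/3)`, and `M *
    -- M^(2/3)` is the square of `M^(5/6)`.
    have hM53 : (M : ℝ) * (M : ℝ) ^ (2 / 3 : ℝ) ≤ E ^ 2 := by
      have : (M : ℝ) * (M : ℝ) ^ (2 / 3 : ℝ) = P ^ 2 := by
        rw [hPsq]
        nth_rw 1 [← Real.rpow_one (M : ℝ)]
        rw [hrpow]; norm_num
      rw [this]; gcongr
    have h3 : (M : ℝ) * (M / U) ≤ 2 * E ^ 2 := by
      have := mul_le_mul_of_nonneg_left hMU hM'.le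
      linarith
    have h4 : (M : ℝ) * U ^ 2 ≤ E ^ 2 := (mul_le_mul_of_nonneg_left hU2 hM'.le).trans hM53
    exact sqrt_mul_sq_mul_le hlog20 hlog2 hlq0 hlq hℓ2 hE0 h1 h3 h4 h2
  have hsm := norm_sum_smooth_le α a q hq hg hα M U hU
  have hsm' : ‖∑ n ∈ Finset.Icc 1 M with maxFac n ≤ U ^ 2, expTwoPi (α * n)‖
      ≤ E + 54 * ℓ ^ 3 * E := by
    refine hsm.trans (add_le_add hUE ?_)
    calc _ ≤ (3 * ℓ) * (18 * ℓ ^ 2 * E) := by gcongr; linarith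
      _ = _ := by ring
  have hprime := norm_sum_multipleSum_prime_le α M U hU hU4
  have hpow := norm_sum_exactSum_le (f := f) α M U hU F hF hF1
  have hpow' : 4 * F * (T + Nat.log 2 M * (M / U) * (1 + ℓ)) ≤ 4 * F * (52 * E * ℓ) := by
    have h1 : (Nat.log 2 M : ℝ) * (M / U) * (1 + ℓ) ≤ 28 * E * ℓ := by
      calc (Nat.log 2 M : ℝ) * (M / U) * (1 + ℓ) = Nat.log 2 M * (M / U * (1 + ℓ)) := by ring
        _ ≤ (2 * ℓ) * (14 * E) := by gcongr
        _ = _ := by ring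
    gcongr
    linarith
  rw [hf.sum_eq]
  refine (norm_add_le _ _).trans ?_
  -- The `ω` part costs only `ℓ³`; the fourth power of `ℓ ≥ 2` swallows the lower-order terms. The
  -- constant 220 covers this 54 and the 208 from prime powers.
  have hcmp1 : 48 * E * ℓ + (E + 54 * ℓ ^ 3 * E) ≤ 54 * E * ℓ ^ 4 := by
    have h1 : 4 * ℓ ≤ ℓ ^ 3 := by
      have : 2 ^ 2 ≤ ℓ ^ 2 := by gcongr
      calc 4 * ℓ = 2 ^ 2 * ℓ := by ring
        _ ≤ ℓ ^ 2 * ℓ := by gcongr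
        _ = ℓ ^ 3 := by ring
    have h2 : 2 * ℓ ^ 3 ≤ ℓ ^ 4 := by
      calc 2 * ℓ ^ 3 ≤ ℓ * ℓ ^ 3 := by gcongr
        _ = ℓ ^ 4 := by ring
    calc 48 * E * ℓ + (E + 54 * ℓ ^ 3 * E) = E * (48 * ℓ + 1 + 54 * ℓ ^ 3) := by ring
      _ ≤ E * (54 * ℓ ^ 4) := by gcongr; linarith
      _ = 54 * E * ℓ ^ 4 := by ring
  have hEF : 0 ≤ E * (ℓ * F) := by positivity
  have hEl : 0 ≤ E * ℓ ^ 4 := by positivity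
  have h1 : 4 * F * (52 * E * ℓ) = 208 * (E * (ℓ * F)) := by ring
  have h2 : 220 * E * (ℓ ^ 4 + ℓ * F) = 220 * (E * ℓ ^ 4) + 220 * (E * (ℓ * F)) := by ring
  rw [h2]
  linarith

theorem expSum_eq (f : ℕ → ℂ) (α X : ℝ) :
    expSum f α X = ∑ n ∈ Finset.Icc 1 ⌊X⌋₊, f n * expTwoPi (α * n) := rfl

theorem norm_le_primePowMax (f : ℕ → ℂ) (X : ℝ) (hX : 2 ≤ X) (p l : ℕ) (hp : p.Prime) (hl : 1 ≤ l)
    (h : p ^ l ≤ ⌊X⌋₊) : ‖f (p ^ l)‖ ≤ primePowMax f X :=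
  (primePowMax_isGreatest f X hX).2
    ⟨p, l, hp, hl, (Nat.le_floor_iff (by linarith)).1 h, rfl⟩

theorem theorem1 :
    ∃ C : ℝ, 0 < C ∧ ∃ X₀ : ℝ, 2 ≤ X₀ ∧
      ∀ (f : ℕ → ℂ), IsClassFZero f →
      ∀ (α : ℝ) (a : ℤ) (q : ℕ), 0 < q → Int.gcd a (q : ℤ) = 1 →
        |α - (a : ℝ) / (q : ℝ)| ≤ 1 / (q : ℝ) ^ 2 →
      ∀ Δ : ℝ, 0 < Δ → Δ < 1 / 2 →
      ∀ X : ℝ, X₀ ≤ X →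
        ‖expSum f α X‖ ≤
          C * (X / (q : ℝ) ^ Δ + X ^ (5 / 6 : ℝ) + X ^ (1 - Δ) * (q : ℝ) ^ Δ) *
            ((Real.log X) ^ 4 + Real.log X * primePowMax f X) := by
  refine ⟨220, by norm_num, 27, by norm_num, ?_⟩
  intro f hf α a q hq hg hα Δ hΔ0 hΔ X hX
  have hX0 : (0 : ℝ) < X := by linarith
  have hX1 : (1 : ℝ) ≤ X := by linarith
  have hq0 : (0 : ℝ) < q := by exact_mod_cast hq
  have hq1 : (1 : ℝ) ≤ q := by exact_mod_cast hq
  set M := ⌊X⌋₊ with hMdef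
  set F := primePowMax f X
  have hM27 : 27 ≤ M := Nat.le_floor (by exact_mod_cast hX)
  have hM0 : (0 : ℝ) < M := by exact_mod_cast (by omega : 0 < M)
  have hMX : (M : ℝ) ≤ X := Nat.floor_le hX0.le
  have hF : ∀ p l : ℕ, p.Prime → 1 ≤ l → p ^ l ≤ M → ‖f (p ^ l)‖ ≤ F :=
    norm_le_primePowMax f X (by linarith)
  have hF1 : 1 ≤ F := by
    have := hF 2 1 Nat.prime_two le_rfl (by omega)
    rwa [pow_one, hf.prime_eq_one 2 Nat.prime_two, norm_one] at this
  have hlogM : Real.log M ≤ Real.log X := Real.log_le_log hM0 hMX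
  have hlogM0 : 0 ≤ Real.log M := Real.log_natCast_nonneg M
  have hlogX0 : 0 ≤ Real.log X := hlogM0.trans hlogM
  rw [expSum_eq]
  by_cases hqM : q ≤ M
  · refine (hf.norm_sum_le α a q hq hg hα M hM27 hqM F hF hF1).trans ?_
    have hqX : (q : ℝ) ≤ X := le_trans (by exact_mod_cast hqM) hMX
    have h1 : (M : ℝ) / √q ≤ X / (q : ℝ) ^ Δ := by
      have : (q : ℝ) ^ Δ ≤ √q := by
        rw [Real.sqrt_eq_rpow]
        exact Real.rpow_le_rpow_of_exponent_le hq1 hΔ.le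
      gcongr
    have h2 : (M : ℝ) ^ (5 / 6 : ℝ) ≤ X ^ (5 / 6 : ℝ) := by gcongr
    -- Here `q ≤ X` and `Δ < 1/2` allow `q^(1/2 - Δ)` to be traded for `X^(1/2 - Δ)`.
    have h3 : √(M * q) ≤ X ^ (1 - Δ) * (q : ℝ) ^ Δ := by
      calc √(M * q) ≤ √(X * q) := by gcongr
        _ = X ^ (1 / 2 : ℝ) * ((q : ℝ) ^ Δ * (q : ℝ) ^ (1 / 2 - Δ)) := by
            rw [← Real.rpow_add hq0, add_sub_cancel, ← Real.mul_rpow hX0.le hq0.le,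
              Real.sqrt_eq_rpow]
        _ ≤ X ^ (1 / 2 : ℝ) * ((q : ℝ) ^ Δ * X ^ (1 / 2 - Δ)) := by gcongr
        _ = (X ^ (1 / 2 : ℝ) * X ^ (1 / 2 - Δ)) * (q : ℝ) ^ Δ := by ring
        _ = X ^ (1 - Δ) * (q : ℝ) ^ Δ := by
            rw [← Real.rpow_add hX0]; ring_nf
    gcongr
  -- Trivial range: `f` is bounded pointwise by the number of prime factors times `F`, and `X =
  -- X^(1-Δ) X^Δ ≤ X^(1-Δ) q^Δ`.
  · have hXq : X ≤ q := (Nat.lt_of_floor_lt (not_le.1 hqM)).le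
    have h1 : ‖∑ n ∈ Finset.Icc 1 M, f n * expTwoPi (α * n)‖ ≤ M * (Nat.log 2 M * F) := by
      refine (norm_sum_le _ _).trans ((Finset.sum_le_card_nsmul _ _ (Nat.log 2 M * F) ?_).trans_eq
        (by simp))
      intro n hn
      rw [Finset.mem_Icc] at hn
      rw [norm_mul, norm_expTwoPi, mul_one]
      exact hf.norm_apply_le M F hF hF1 n hn.1 hn.2
    have h2 : X ≤ X ^ (1 - Δ) * (q : ℝ) ^ Δ := by
      calc X = X ^ (1 - Δ) * X ^ Δ := by
            rw [← Real.rpow_add hX0, sub_add_cancel, Real.rpow_one]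
        _ ≤ X ^ (1 - Δ) * (q : ℝ) ^ Δ := by gcongr
    have h3 : X ≤ X / (q : ℝ) ^ Δ + X ^ (5 / 6 : ℝ) + X ^ (1 - Δ) * (q : ℝ) ^ Δ := by
      have : 0 ≤ X / (q : ℝ) ^ Δ + X ^ (5 / 6 : ℝ) := by positivity
      linarith
    have h4 : (Nat.log 2 M : ℝ) ≤ 2 * Real.log X :=
      (natLog_two_le_two_mul_log M (by omega)).trans (by linarith)
    have h5 : Real.log X * F ≤ Real.log X ^ 4 + Real.log X * F := by
      have : 0 ≤ Real.log X ^ 4 := by positivity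
      linarith
    refine h1.trans ?_
    calc (M : ℝ) * (Nat.log 2 M * F) ≤ X * ((2 * Real.log X) * F) := by gcongr
      _ = 2 * X * (Real.log X * F) := by ring
      _ ≤ 220 * (X / (q : ℝ) ^ Δ + X ^ (5 / 6 : ℝ) + X ^ (1 - Δ) * (q : ℝ) ^ Δ) *
            (Real.log X ^ 4 + Real.log X * F) := by
          gcongr
          norm_num
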